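/- **Setting.** Let $\Omega=(X_0,X_0+L)$ with $L>0$, $M\ge 1$, $h=L/M$, and $X_r=X_0+rh$ for integer and half-integer $r$. For a function $l$ on the nodes $X_0,\dots,X_M$ and a function $\phi$ on the midpoints $X_{1/2},\dots,X_{M-1/2}$ put $$(D_hl)_{i-\frac12}=\frac{l_i-l_{i-1}}h\ (1\le i\le M),\qquad (d_h\phi)_i=\frac{\phi_{i+\frac12}-\phi_{i-\frac12}}h,\qquad (\widetilde D_hl)_i=\frac{l_{i+1}-l_{i-1}}{2h}\ (1\le i\le M-1),$$ and $\langle\phi,\psi\rangle=h\sum_{i=1}^M\phi_{i-\frac12}\psi_{i-\frac12}$. Let $\mathcal Q$ be the set of node functions $l$ with $l_{i-1}<l_i$ for $1\le i\le M$, $l_0=X_0$, $l_M=X_M$. Let $f_0$ be a real function on $\overline\Omega$, $\tau>0$, $m>1$, $A_0\ge 0$, $x^n,x^{n-1}\in\mathcal Q$, and at the interior nodes put $$S=\max\bigl(\widetilde D_h(\tfrac32x^n-\tfrac12x^{n-1}),\tau^2\bigr),\qquad c_i=\frac{f_0(X_i)}{m\,(f_0(X_i)/S_i)^{m-1}}.$$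 For $y,p>0$ let $R(y,p)=\frac{\ln y-\ln p}{y-p}$ if $y\ne p$ and $R(p,p)=\frac1p$; let $W(y,p)=\frac{(1-p/y)+\ln(p/y)}{(y-p)^2}$ if $y\neq p$ and $W(p,p)=-\frac1{2p^2}$. The scheme is: find $x^{n+1}\in\mathcal Q$ such that, for $1\le i\le M-1$, $$c_i\frac{x_i^{n+1}-x_i^n}{\tau}=-d_h\Bigl[f_0\,R(D_hx^{n+1},D_hx^n)-A_0\tau D_h(x^{n+1}-x^n)+\tau^2\Bigl(\frac1{D_hx^{n+1}}-\frac1{D_hx^n}\Bigr)\Bigr]_i .$$ In the variable $\hat x=x-X$, which vanishes at $X_0$ and $X_M$ and is identified with its interior values in $\mathbb R^{M-1}$, define on the translated admissible set $\hat{\mathcal Q}=\{\hat x: X+\hat x\in\mathcal Q\}$ the functional $F=F_1+F_2+F_3+F_4$, where $$F_1=\frac h{2\tau}\sum_{i=1}^{M-1}c_i(X_i+\hat x_i-x_i^n)^2,\qquad F_2=\langle f_0\,G(D_h\hat x,D_hx^n),1\rangle,\qquad G(x,x_0)=\int_x^0R(1+t,x_0)\,dt,$$ $$F_3=A_0\tau\bigl(\tfrac12\langle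 D_h\hat x,D_h\hat x\rangle-\langle D_h\hat x,D_hx^n\rangle\bigr),\qquad F_4=\tau^2\bigl(-\langle\ln(1+D_h\hat x),1\rangle+\langle D_h\hat x,1/D_hx^n\rangle\bigr).$$ A function $\Lambda$ on an open nonempty convex subset $Q$ of a finite-dimensional real vector space is *self-concordant on $Q$ with parameter $a>0$* if it is $C^3$ and convex on $Q$ and $|D^3\Lambda(x)[u,u,u]|\le 2a^{-1/2}(D^2\Lambda(x)[u,u])^{3/2}$ for all $x\in Q$ and all vectors $u$. **Damped Newton iteration** (parameters $a>0$ and $\lambda'\in[2-\sqrt3,1)$). Put $x^{n+1,0}=x^n$ and $x^{n+1,k+1}=x^{n+1,k}+\omega(\lambda_k)\,\delta$, where $\delta_0=\delta_M=0$ and, for $1\le i\le M-1$, with $x=x^{n+1,k}$, $$c_i\frac{\delta_i}\tau-d_h\Bigl[\Bigl(-f_0W(D_hx,D_hx^n)+A_0\tau+\frac{\tau^2}{(D_hx)^2}\Bigr)D_h\delta\Bigr]_i=-c_i\frac{x_i-x_i^n}\tau-d_h\Bigl[f_0R(D_hx,D_hx^n)-A_0\tau D_h(x-x^n)+\tau^2\Bigl(\frac1{D_hx}-\frac1{D_hx^n}\Bigr)\Bigr]_i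 .$$ Here, with $F'$ and $F''$ the gradient vector and the Hessian matrix of $F$, $$\lambda_k\ge0,\qquad \lambda_k^2=\tfrac1a\,F'(\hat x)^T[F''(\hat x)]^{-1}F'(\hat x)\quad\text{at } \hat x=x^{n+1,k}-X,$$ and $\omega(\lambda)=\frac1{1+\lambda}$ for $\lambda>\lambda'$, $\ \omega(\lambda)=\frac{1-\lambda}{\lambda(3-\lambda)}$ for $2-\sqrt3\le\lambda\le\lambda'$, $\ \omega(\lambda)=1$ for $\lambda<2-\sqrt3$. **Theorem.** Assume that $f_0$ has a positive lower bound on $\overline\Omega$. Then there is a constant $C_0>0$, depending only on $\Omega$, $f_0$ and $\tau$ (not on $M$, $m$, $A_0$, $x^n$, $x^{n-1}$, $\lambda'$), such that for every constant $C_{Newton}\ge C_0$ and with $$a=\frac{h\,\min_{0\le i\le M}f_0(X_i)}{2\,C_{Newton}^2}$$ the following hold for all $M$, $m$, $A_0$, $x^n$, $x^{n-1}$ as above. 1. $F$ is self-concordant with parameter $a$ on $\hat{\mathcal Q}$, and its Hessian matrix is positive definite there. 2. For every $\lambda'\in[2-\sqrt3,1)$ the damped Newton iteration is well defined (it produces exactly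 one sequence), all its iterates lie in $\mathcal Q$, and they converge to a point $x^{n+1}\in\mathcal Q$ which solves the scheme and for which $x^{n+1}-X$ minimizes $F$ over $\hat{\mathcal Q}$. -/

import Mathlib

open Set Filter Topology

noncomputable section

/-- Self-concordance with parameter value `a` on an open nonempty convex subset `Q` of a
finite-dimensional real vector space. -/
structure IsSelfConcordantOn {E : Type*} [NormedAddCommGroup E] [NormedSpace ℝ E]
    [FiniteDimensional ℝ E] (Q : Set E) (Φ : E → ℝ) (a : ℝ) : Prop where
  param_pos : 0 < a
  isOpen : IsOpen Q
  nonempty : Q.Nonempty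
  convex : Convex ℝ Q
  contDiffOn : ContDiffOn ℝ 3 Φ Q
  convexOn : ConvexOn ℝ Q Φ
  bound : ∀ x ∈ Q, ∀ u : E,
    |iteratedFDeriv ℝ 3 Φ x ![u, u, u]|
      ≤ 2 * a ^ (-(1 / 2) : ℝ) * (iteratedFDeriv ℝ 2 Φ x ![u, u]) ^ (3 / 2 : ℝ)

/-- The difference quotient `(ln y - ln y₀) / (y - y₀)`, with its continuous value `1 / y`
at `y = y₀`. -/
def logQuot (y y₀ : ℝ) : ℝ :=
  if y = y₀ then 1 / y else (Real.log y - Real.log y₀) / (y - y₀)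

/-- The derivative of `logQuot` in its first argument (for positive arguments). -/
def logQuotW (y y₀ : ℝ) : ℝ :=
  if y = y₀ then -(1 / (2 * y ^ 2))
  else ((1 - y₀ / y) + Real.log (y₀ / y)) / (y - y₀) ^ 2

/-- `G (x, x₀) = ∫_x^0 (ln (1 + t) - ln x₀) / (1 + t - x₀) dt`. -/
def primG (x x₀ : ℝ) : ℝ := ∫ t in x..0, logQuot (1 + t) x₀

/-- The damping factor of the Newton iteration, with threshold `lam' ∈ [2 - √3, 1)`. -/
def dampingFactor (lam' lam : ℝ) : ℝ :=
  if lam' < lam then 1 / (1 + lam)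
  else if 2 - Real.sqrt 3 ≤ lam then (1 - lam) / (lam * (3 - lam))
  else 1

/-- The data of one time step of the scheme on the domain `(X₀, X₀ + L)` with `M = N + 1` cells.
A function on the nodes `X_0, …, X_M` is an element of `Fin (N + 2) → ℝ`, a function on the
midpoints `X_{1/2}, …, X_{M-1/2}` is an element of `Fin (N + 1) → ℝ` (the index `i` stands for
`X_{i+1/2}`), and a function on the interior nodes `X_1, …, X_{M-1}` is an element of
`Fin N → ℝ` (the index `j` stands for `X_{j+1}`). -/
structure StepData (N : ℕ) where
  /-- left end point of the domain -/
  X₀ : ℝ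
  /-- length of the domain -/
  L : ℝ
  /-- initial density -/
  f₀ : ℝ → ℝ
  /-- time step -/
  τ : ℝ
  /-- exponent of the porous medium equation -/
  m : ℝ
  /-- coefficient of the artificial regularization term -/
  A₀ : ℝ
  /-- the particle positions at time level `n` -/
  xn : Fin (N + 2) → ℝ
  /-- the particle positions at time level `n - 1` -/
  xnm : Fin (N + 2) → ℝ

/-- The position of the interior node number `j` in the list of all nodes. -/
def interiorIdx {N : ℕ} (j : Fin N) : Fin (N + 2) := j.castSucc.succ

/-- Extension of an interior grid function by zero to both boundary nodes. -/
def extZero {N : ℕ} (v : Fin N → ℝ) : Fin (N + 2) → ℝ :=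
  Fin.cons (α := fun _ => ℝ) 0 (Fin.snoc (α := fun _ => ℝ) v 0)

namespace StepData

variable {N : ℕ} (P : StepData N)

/-- The mesh size `h = |Ω| / M`. -/
def h : ℝ := P.L / (N + 1)

/-- `X_r = X_0 + r h`. -/
def pos (r : ℝ) : ℝ := P.X₀ + r * P.h

/-- The grid function `X`. -/
def grid (i : Fin (N + 2)) : ℝ := P.pos (i : ℕ)

/-- `f_0` at the node `X_i`. -/
def fNode (i : Fin (N + 2)) : ℝ := P.f₀ (P.grid i)

/-- `f_0` at the midpoint `X_{i+1/2}`. -/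
def fMid (i : Fin (N + 1)) : ℝ := P.f₀ (P.pos ((i : ℕ) + 1 / 2))

/-- `min_{0 ≤ i ≤ M} f_0(X_i)`. -/
def minf : ℝ := Finset.univ.inf' Finset.univ_nonempty P.fNode

/-- `D_h`, from nodes to midpoints. -/
def Dh (l : Fin (N + 2) → ℝ) (i : Fin (N + 1)) : ℝ := (l i.succ - l i.castSucc) / P.h

/-- `d_h`, from midpoints to interior nodes. -/
def dh (φ : Fin (N + 1) → ℝ) (j : Fin N) : ℝ := (φ j.succ - φ j.castSucc) / P.h

/-- The central difference `(l_{i+1} - l_{i-1}) / 2h` at the interior nodes. -/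
def tDh (l : Fin (N + 2) → ℝ) (j : Fin N) : ℝ :=
  (l j.succ.succ - l j.castSucc.castSucc) / (2 * P.h)

/-- `S_h (x^n, x^{n-1})` at the interior nodes. -/
def S (j : Fin N) : ℝ :=
  max (P.tDh (fun i => 3 / 2 * P.xn i - 1 / 2 * P.xnm i) j) (P.τ ^ 2)

/-- The coefficient `f_0 / (m (f_0 / S_h)^{m-1})` at the interior nodes. -/
def coeff (j : Fin N) : ℝ :=
  P.fNode (interiorIdx j) / (P.m * (P.fNode (interiorIdx j) / P.S j) ^ (P.m - 1))

/-- The admissible set. -/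
def Q : Set (Fin (N + 2) → ℝ) :=
  {l | (∀ i : Fin (N + 1), l i.castSucc < l i.succ) ∧ l 0 = P.X₀ ∧
    l (Fin.last (N + 1)) = P.X₀ + P.L}

/-- The admissible set in the variable `x̂ = x - X`, which vanishes at both boundary nodes and is
identified with its interior values. -/
def hatQ : Set (Fin N → ℝ) := {v | P.grid + extZero v ∈ P.Q}

/-- The interior values of `x̂ = x - X`. -/
def hat (x : Fin (N + 2) → ℝ) (j : Fin N) : ℝ := x (interiorIdx j) - P.grid (interiorIdx j)

/-- The nonlinear scheme: `y` is an admissible solution `x^{n+1}`. -/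
def IsSchemeSolution (y : Fin (N + 2) → ℝ) : Prop :=
  y ∈ P.Q ∧ ∀ j : Fin N,
    P.coeff j * ((y (interiorIdx j) - P.xn (interiorIdx j)) / P.τ)
      = -P.dh (fun i => P.fMid i * logQuot (P.Dh y i) (P.Dh P.xn i)
          - P.A₀ * P.τ * P.Dh (y - P.xn) i
          + P.τ ^ 2 * (1 / P.Dh y i - 1 / P.Dh P.xn i)) j

/-- The discrete inner product of functions on the midpoints. -/
def innerMid (φ ψ : Fin (N + 1) → ℝ) : ℝ := P.h * ∑ i, φ i * ψ i

/-- `F_1`. In the inner product over the nodes only the interior ones contribute, because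
`X + x̂ - x^n` vanishes at both boundary nodes. -/
def F₁ (v : Fin N → ℝ) : ℝ :=
  1 / (2 * P.τ) * (P.h * ∑ j : Fin N,
    P.coeff j * (P.grid (interiorIdx j) + v j - P.xn (interiorIdx j)) ^ 2)

def F₂ (v : Fin N → ℝ) : ℝ :=
  P.innerMid (fun i => P.fMid i * primG (P.Dh (extZero v) i) (P.Dh P.xn i)) (fun _ => 1)

def F₃ (v : Fin N → ℝ) : ℝ :=
  P.A₀ * P.τ * (1 / 2 * P.innerMid (P.Dh (extZero v)) (P.Dh (extZero v))
    - P.innerMid (P.Dh (extZero v)) (P.Dh P.xn))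

def F₄ (v : Fin N → ℝ) : ℝ :=
  P.τ ^ 2 * (-P.innerMid (fun i => Real.log (1 + P.Dh (extZero v) i)) (fun _ => 1)
    + P.innerMid (P.Dh (extZero v)) (fun i => 1 / P.Dh P.xn i))

/-- The discrete functional. -/
def F (v : Fin N → ℝ) : ℝ := P.F₁ v + P.F₂ v + P.F₃ v + P.F₄ v

/-- The gradient vector of `F`. -/
def grad (v : Fin N → ℝ) : Fin N → ℝ := fun j => fderiv ℝ P.F v (Pi.single j 1)

/-- The Hessian matrix of `F`. -/
def hess (v : Fin N → ℝ) : Matrix (Fin N) (Fin N) ℝ :=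
  Matrix.of fun i j => iteratedFDeriv ℝ 2 P.F v ![Pi.single i 1, Pi.single j 1]

/-- The Newton decrement `λ`, with `λ² = (1 / a) F'ᵀ (F'')⁻¹ F'`. -/
def newtonDecrement (a : ℝ) (v : Fin N → ℝ) : ℝ :=
  Real.sqrt (1 / a * (P.grad v ⬝ᵥ Matrix.mulVec (P.hess v)⁻¹ (P.grad v)))

/-- The linear system for the Newton direction `δ` at the current iterate `x`. -/
def IsNewtonDirection (x δ : Fin (N + 2) → ℝ) : Prop :=
  δ 0 = 0 ∧ δ (Fin.last (N + 1)) = 0 ∧ ∀ j : Fin N,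
    P.coeff j * (δ (interiorIdx j) / P.τ)
        - P.dh (fun i => (-(P.fMid i * logQuotW (P.Dh x i) (P.Dh P.xn i))
            + P.A₀ * P.τ + P.τ ^ 2 / (P.Dh x i) ^ 2) * P.Dh δ i) j
      = -(P.coeff j * ((x (interiorIdx j) - P.xn (interiorIdx j)) / P.τ))
        - P.dh (fun i => P.fMid i * logQuot (P.Dh x i) (P.Dh P.xn i)
            - P.A₀ * P.τ * P.Dh (x - P.xn) i
            + P.τ ^ 2 * (1 / P.Dh x i - 1 / P.Dh P.xn i)) j

/-- `x` is a sequence of iterates of the damped Newton iteration started at `x^n`. -/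
def IsDampedNewton (a lam' : ℝ) (x : ℕ → Fin (N + 2) → ℝ) : Prop :=
  x 0 = P.xn ∧ ∀ k : ℕ, ∃ δ : Fin (N + 2) → ℝ, P.IsNewtonDirection (x k) δ ∧
    x (k + 1) = x k + dampingFactor lam' (P.newtonDecrement a (P.hat (x k))) • δ

end StepData

end

/-! The functional is a sum of functions of one variable composed with linear forms: one term per
cell, depending on the slope `D_h x̂` there, and one quadratic term per interior node. Its
derivatives are therefore weighted sums of powers of these forms, and everything reduces to
one-variable estimates.

The quotient `R(y,p)` equals `∫₀¹ ds / ((1-s)p + sy)`. This removes the case distinction at `y = p`,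
gives smoothness, and makes signs and comparisons visible in the integrand. For a cell term `φ` and
relative length `y = 1 + s` it yields `φ'' ≥ hτ²/y²` (from the logarithmic barrier) and `|φ'''| ≤
(2/y) φ''`. Hence `φ` is self-concordant with every parameter `a ≤ hτ²`
(`abs_cellFun_three_le_rpow`), and this property passes to sums (`Separable.isSelfConcordantOn`).
The node terms make the Hessian positive definite.

For the iteration, `C₀` is taken so large that `16a ≤ hτ²`. A Newton direction with decrement `λ`
then changes each cell length by at most the fraction `λ/4`, so a step of size `t` with `tλ ≤ 1`
keeps at least three quarters of each cell, and the Hessian grows at most by the factor `16/9` along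
the step. Taylor's inequality gives a decrease of at least `aλ²t/9` for `t ≤ 1` (`descent`). The
damping rule enters only through `0 < ω ≤ 1`, `ωλ ≤ 1` and a lower bound of order `1/(1+λ)`.

The barrier confines sublevel sets to compact subsets of the domain (`exists_thickSet`), so a
minimizer exists and, `F` being bounded below, the decrements tend to zero. Quadratic monotonicity
of the gradient and Cauchy–Schwarz in the Hessian form bound the distance to the minimizer by the
decrement (`weight_mul_sq_le_newtonDecrement`). Summation by parts identifies critical points with
solutions of the scheme and Newton systems with the given linear systems. -/

noncomputable section

/-! ### Integral representation of the logarithmic difference quotient -/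

/-- The integral `∫₀¹ sᵏ / ((1 - s) p + s y)ᵏ⁺¹ ds`. For `k = 0` it is the difference quotient of
the logarithm, and up to factors `-(k + 1)` each one is the derivative of the preceding one. -/
def kernelInt (k : ℕ) (p y : ℝ) : ℝ :=
  ∫ s in (0 : ℝ)..1, s ^ k / ((1 - s) * p + s * y) ^ (k + 1)

theorem segment_pos {p y s : ℝ} (hp : 0 < p) (hy : 0 < y) (hs : s ∈ Icc (0 : ℝ) 1) :
    0 < (1 - s) * p + s * y := by
  obtain ⟨h0, h1⟩ := hs
  rcases h0.eq_or_lt with rfl | h0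
  · simpa using hp
  · have : 0 ≤ (1 - s) * p := mul_nonneg (by linarith) hp.le
    have : 0 < s * y := mul_pos h0 hy
    linarith

theorem continuousOn_kernel (k n : ℕ) {p y : ℝ} (hp : 0 < p) (hy : 0 < y) :
    ContinuousOn (fun s : ℝ => s ^ k / ((1 - s) * p + s * y) ^ n) (Icc 0 1) :=
  ContinuousOn.div (by fun_prop) (by fun_prop)
    fun _ hs => pow_ne_zero _ (segment_pos hp hy hs).ne'

theorem intervalIntegrable_kernel (k n : ℕ) {p y : ℝ} (hp : 0 < p) (hy : 0 < y) :
    IntervalIntegrable (fun s : ℝ => s ^ k / ((1 - s) * p + s * y) ^ n)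
      MeasureTheory.volume 0 1 :=
  ContinuousOn.intervalIntegrable (by simpa using continuousOn_kernel k n hp hy)

theorem hasDerivAt_kernelInt (k : ℕ) {p y : ℝ} (hp : 0 < p) (hy : 0 < y) :
    HasDerivAt (kernelInt k p) (-(k + 1) * kernelInt (k + 1) p y) y := by
  -- For `x > y/2` every point of the segment from `p` to `x` is at least `ρ`, which gives an
  -- integrable bound for the derivative uniformly near `y`.
  set ρ := min p (y / 2) with hρ
  have hρ0 : 0 < ρ := lt_min hp (by linarith)
  have hlow : ∀ s ∈ Icc (0 : ℝ) 1, ∀ x ∈ Ioi (y / 2), ρ ≤ (1 - s) * p + s * x := by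
    rintro s ⟨h0, h1⟩ x hx
    have h2 : ρ ≤ p := min_le_left _ _
    have h3 : ρ ≤ x := (min_le_right _ _).trans (le_of_lt hx)
    nlinarith [mul_nonneg (sub_nonneg.2 h1) (sub_nonneg.2 h2), mul_nonneg h0 (sub_nonneg.2 h3)]
  have hsub : uIoc (0 : ℝ) 1 ⊆ Icc 0 1 := by
    rw [uIoc_of_le zero_le_one]; exact Ioc_subset_Icc_self
  have key := (intervalIntegral.hasDerivAt_integral_of_dominated_loc_of_deriv_le
    (μ := MeasureTheory.volume) (a := (0 : ℝ)) (b := 1) (x₀ := y) (s := Ioi (y / 2))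
    (F := fun x s => s ^ k / ((1 - s) * p + s * x) ^ (k + 1))
    (F' := fun x s => -(k + 1) * (s ^ (k + 1) / ((1 - s) * p + s * x) ^ (k + 2)))
    (bound := fun _ => (k + 1) * (1 / ρ ^ (k + 2)))
    (Ioi_mem_nhds (by linarith)) ?_ (intervalIntegrable_kernel k (k + 1) hp hy) ?_ ?_ ?_ ?_).2
  · rw [kernelInt, ← intervalIntegral.integral_const_mul]
    exact key
  · filter_upwards [Ioi_mem_nhds hy] with x hx
    exact ((continuousOn_kernel k (k + 1) hp hx).mono hsub).aestronglyMeasurable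
      measurableSet_uIoc
  · exact (((continuousOn_kernel (k + 1) (k + 2) hp hy).const_mul _).mono
      hsub).aestronglyMeasurable measurableSet_uIoc
  · refine Eventually.of_forall fun s hs x hx => ?_
    have hl := hlow s (hsub hs) x hx
    have hk : (0 : ℝ) ≤ k + 1 := by positivity
    rw [norm_mul, norm_neg, Real.norm_of_nonneg hk, Real.norm_of_nonneg
      (div_nonneg (pow_nonneg (hsub hs).1 _) (pow_nonneg (hρ0.le.trans hl) _))]
    gcongr
    exact pow_le_one₀ (hsub hs).1 (hsub hs).2
  · simp
  · refine Eventually.of_forall fun s hs x hx => ?_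
    have hD : (1 - s) * p + s * x ≠ 0 := (hρ0.trans_le (hlow s (hsub hs) x hx)).ne'
    have h1 : HasDerivAt (fun x => (1 - s) * p + s * x) s x := by
      simpa using ((hasDerivAt_id x).const_mul s).const_add ((1 - s) * p)
    have h2 := (h1.pow (k + 1)).fun_inv (pow_ne_zero _ hD) |>.const_mul (s ^ k)
    refine h2.congr_deriv ?_
    simp only [Pi.pow_apply, Nat.add_sub_cancel, Nat.cast_add, Nat.cast_one]
    field_simp
    ring

theorem contDiffOn_kernelInt (n k : ℕ) {p : ℝ} (hp : 0 < p) :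
    ContDiffOn ℝ n (kernelInt k p) (Ioi 0) := by
  induction n generalizing k with
  | zero =>
    exact contDiffOn_zero.2 fun y hy => (hasDerivAt_kernelInt k hp hy).continuousAt.continuousWithinAt
  | succ n ih =>
    push_cast
    refine (contDiffOn_succ_iff_deriv_of_isOpen isOpen_Ioi).2
      ⟨fun y hy => (hasDerivAt_kernelInt k hp hy).differentiableAt.differentiableWithinAt,
        by simp, ?_⟩
    exact ((contDiffOn_const (c := -((k : ℝ) + 1))).mul (ih (k + 1))).congr fun y hy =>
      (hasDerivAt_kernelInt k hp hy).deriv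

theorem kernelInt_nonneg (k : ℕ) {p y : ℝ} (hp : 0 < p) (hy : 0 < y) : 0 ≤ kernelInt k p y :=
  intervalIntegral.integral_nonneg zero_le_one fun _ hs =>
    div_nonneg (pow_nonneg hs.1 _) (pow_nonneg (segment_pos hp hy hs).le _)

/-- Pointwise in the integrand: `s y` is at most the denominator `(1-s)p + sy`. This is what bounds
the third derivative of a cell term by its second. -/
theorem kernelInt_two_le {p y : ℝ} (hp : 0 < p) (hy : 0 < y) :
    kernelInt 2 p y ≤ kernelInt 1 p y / y := by
  rw [kernelInt, kernelInt, ← intervalIntegral.integral_div]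
  refine intervalIntegral.integral_mono_on zero_le_one (intervalIntegrable_kernel 2 3 hp hy)
    ((intervalIntegrable_kernel 1 2 hp hy).div_const y) fun s hs => ?_
  have hD := segment_pos hp hy hs
  have h1 : s * y ≤ (1 - s) * p + s * y := by nlinarith [hs.1, hs.2]
  have h0 := hs.1
  set D := (1 - s) * p + s * y
  rw [div_div, div_le_div_iff₀ (by positivity) (by positivity)]
  have h2 : 0 ≤ s * D ^ 2 := by positivity
  calc s ^ 2 * (D ^ (1 + 1) * y) = s * D ^ 2 * (s * y) := by ring
    _ ≤ s * D ^ 2 * D := by gcongr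
    _ = s ^ 1 * D ^ (2 + 1) := by ring

/-- Shrinking `y` by the factor `1 - r` shrinks the denominator `(1-s)p + sy` by no more than that
factor. Used to compare Hessians along a Newton step. -/
theorem kernelInt_one_le_of_le {p y z r : ℝ} (hp : 0 < p) (hy : 0 < y) (hr0 : 0 ≤ r) (hr : r < 1)
    (hz : (1 - r) * y ≤ z) : kernelInt 1 p z ≤ kernelInt 1 p y / (1 - r) ^ 2 := by
  have hr1 : 0 < 1 - r := by linarith
  have hz0 : 0 < z := (mul_pos hr1 hy).trans_le hz
  rw [kernelInt, kernelInt, ← intervalIntegral.integral_div]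
  refine intervalIntegral.integral_mono_on zero_le_one (intervalIntegrable_kernel 1 2 hp hz0)
    ((intervalIntegrable_kernel 1 2 hp hy).div_const _) fun s hs => ?_
  have hD := segment_pos hp hy hs
  have h1 : (1 - r) * ((1 - s) * p + s * y) ≤ (1 - s) * p + s * z := by
    nlinarith [mul_nonneg hr0 (mul_nonneg (sub_nonneg.2 hs.2) hp.le),
      mul_le_mul_of_nonneg_left hz hs.1]
  have h0 := hs.1
  rw [div_div, ← mul_pow, mul_comm _ (1 - r)]
  gcongr

theorem hasDerivAt_log_segment {p y s : ℝ} (hp : 0 < p) (hy : 0 < y) (hs : s ∈ Icc (0 : ℝ) 1) :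
    HasDerivAt (fun s => Real.log ((1 - s) * p + s * y))
      ((y - p) * (s ^ 0 / ((1 - s) * p + s * y) ^ 1)) s := by
  have h1 : HasDerivAt (fun s => (1 - s) * p + s * y) (y - p) s := by
    refine ((((hasDerivAt_id s).const_sub 1).mul_const p).fun_add
      ((hasDerivAt_id s).mul_const y)).congr_deriv ?_
    ring
  convert h1.log (segment_pos hp hy hs).ne' using 1
  rw [pow_zero, pow_one, mul_one_div]

theorem logQuot_eq_kernelInt {p y : ℝ} (hp : 0 < p) (hy : 0 < y) :
    logQuot y p = kernelInt 0 p y := by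
  unfold logQuot kernelInt
  split_ifs with h
  · subst h
    have : ∀ s : ℝ, (1 - s) * y + s * y = y := fun s => by ring
    simp [this]
  · have h' : y - p ≠ 0 := sub_ne_zero.2 h
    have := intervalIntegral.integral_eq_sub_of_hasDerivAt (a := 0) (b := 1)
      (fun s hs => hasDerivAt_log_segment hp hy (by simpa using hs))
      ((intervalIntegrable_kernel 0 1 hp hy).const_mul (y - p))
    rw [intervalIntegral.integral_const_mul] at this
    rw [div_eq_iff h', mul_comm]
    simpa using this.symm

/-- Off the diagonal, differentiate `(x - p) K₀(x) = ln x - ln p` in two ways, with `K₀` the kernel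
integral for `k = 0`, and solve for the derivative of `K₀`. -/
theorem logQuotW_eq_neg_kernelInt {p y : ℝ} (hp : 0 < p) (hy : 0 < y) :
    logQuotW y p = -kernelInt 1 p y := by
  by_cases h : y = p
  · subst h
    unfold logQuotW kernelInt
    have : ∀ s : ℝ, (1 - s) * y + s * y = y := fun s => by ring
    simp only [this, if_true, pow_one, intervalIntegral.integral_div, integral_id]
    field_simp
    norm_num
  · have h' : y - p ≠ 0 := sub_ne_zero.2 h
    have h1 : HasDerivAt (fun x => (x - p) * kernelInt 0 p x)
        (1 * kernelInt 0 p y + (y - p) * (-((0 : ℕ) + 1) * kernelInt (0 + 1) p y)) y :=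
      ((hasDerivAt_id y).sub_const p).mul (hasDerivAt_kernelInt 0 hp hy)
    have h2 : HasDerivAt (fun x => (x - p) * kernelInt 0 p x) y⁻¹ y := by
      refine ((Real.hasDerivAt_log hy.ne').sub_const (Real.log p)).congr_of_eventuallyEq ?_
      filter_upwards [Ioi_mem_nhds hy] with x hx
      rw [← logQuot_eq_kernelInt hp hx, logQuot]
      split_ifs with hxp
      · simp [hxp]
      · have := sub_ne_zero.2 hxp
        field_simp
    have h3 := h1.unique h2
    rw [← logQuot_eq_kernelInt hp hy, logQuot, if_neg h] at h3
    simp only [Nat.cast_zero, zero_add, one_mul, neg_one_mul] at h3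
    rw [logQuotW, if_neg h, Real.log_div hp.ne' hy.ne']
    field_simp at h3 ⊢
    linear_combination -h3

theorem intervalIntegrable_logQuot {p x : ℝ} (hp : 0 < p) (hx : -1 < x) :
    IntervalIntegrable (fun t => logQuot (1 + t) p) MeasureTheory.volume x 0 := by
  refine ContinuousOn.intervalIntegrable ?_
  have hpos : ∀ t ∈ uIcc x 0, 0 < 1 + t := fun t ht => by
    have := ht.1
    have h2 : -1 < min x 0 := lt_min hx (by norm_num)
    have h3 : min x 0 ≤ t := this
    linarith
  have : ContinuousOn (fun t => kernelInt 0 p (1 + t)) (uIcc x 0) :=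
    ((contDiffOn_kernelInt 0 0 hp).continuousOn).comp (by fun_prop) hpos
  exact this.congr fun t ht => logQuot_eq_kernelInt hp (hpos t ht)

theorem hasDerivAt_primG {p x : ℝ} (hp : 0 < p) (hx : -1 < x) :
    HasDerivAt (fun x => primG x p) (-kernelInt 0 p (1 + x)) x := by
  have hcont : ContinuousOn (fun t => logQuot (1 + t) p) (Ioi (-1)) := by
    have : ContinuousOn (fun t => kernelInt 0 p (1 + t)) (Ioi (-1)) :=
      ((contDiffOn_kernelInt 0 0 hp).continuousOn).comp (by fun_prop)
        (fun t (ht : -1 < t) => by show 0 < 1 + t; linarith)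
    exact this.congr fun t (ht : -1 < t) => logQuot_eq_kernelInt hp (by linarith)
  rw [← logQuot_eq_kernelInt hp (by linarith : 0 < 1 + x)]
  exact intervalIntegral.integral_hasDerivAt_left (intervalIntegrable_logQuot hp hx)
    (hcont.stronglyMeasurableAtFilter isOpen_Ioi x hx) (hcont.continuousAt (Ioi_mem_nhds hx))

theorem kernelInt_zero_anti {p y z : ℝ} (hp : 0 < p) (hy : 0 < y) (hyz : y ≤ z) :
    kernelInt 0 p z ≤ kernelInt 0 p y := by
  refine intervalIntegral.integral_mono_on zero_le_one
    (intervalIntegrable_kernel 0 1 hp (hy.trans_le hyz))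
    (intervalIntegrable_kernel 0 1 hp hy) fun s hs => ?_
  have hD := segment_pos hp hy hs
  have h0 := hs.1
  gcongr

/-- The quotient is decreasing in its first argument, so its primitive lies above its tangent at `x
= 0`. This linear bound suffices for coercivity, which the logarithm provides. -/
theorem neg_mul_kernelInt_le_primG {p x : ℝ} (hp : 0 < p) (hx : -1 < x) :
    -(kernelInt 0 p 1 * x) ≤ primG x p := by
  rcases le_total x 0 with h | h
  · have h1 := intervalIntegral.integral_mono_on h (f := fun _ => kernelInt 0 p 1)
      (by simp) (intervalIntegrable_logQuot hp hx) fun t ht => by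
        have := ht.1
        rw [logQuot_eq_kernelInt hp (by linarith : 0 < 1 + t)]
        exact kernelInt_zero_anti hp (by linarith) (by linarith [ht.2])
    rw [intervalIntegral.integral_const, smul_eq_mul] at h1
    rw [primG]
    linarith
  · have h1 := intervalIntegral.integral_mono_on h (g := fun _ => kernelInt 0 p 1)
      (intervalIntegrable_logQuot hp hx).symm (by simp) fun t ht => by
        have := ht.1
        rw [logQuot_eq_kernelInt hp (by linarith : 0 < 1 + t)]
        exact kernelInt_zero_anti hp (by linarith) (by linarith [ht.1])
    rw [intervalIntegral.integral_const, smul_eq_mul] at h1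
    rw [primG, intervalIntegral.integral_symm]
    linarith

/-! ### Sums of one-variable functions of linear forms -/

/-- A function `F = ∑ k, g k 0 ∘ ℓ k` with linear forms `ℓ k` and functions `g k 0` of one
variable, three times continuously differentiable on the open convex set `U k`, with `j`-th
derivative `g k j`. -/
structure Separable {ι E : Type*} [Fintype ι] [NormedAddCommGroup E] [NormedSpace ℝ E]
    (F : E → ℝ) (ℓ : ι → E →L[ℝ] ℝ) (U : ι → Set ℝ) (g : ι → ℕ → ℝ → ℝ) : Prop where
  eq_sum : ∀ v, F v = ∑ k, g k 0 (ℓ k v)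
  isOpen : ∀ k, IsOpen (U k)
  convex : ∀ k, Convex ℝ (U k)
  hasDerivAt : ∀ k, ∀ j < 3, ∀ t ∈ U k, HasDerivAt (g k j) (g k (j + 1) t) t
  continuousOn : ∀ k, ContinuousOn (g k 3) (U k)
  nonneg : ∀ k, ∀ t ∈ U k, 0 ≤ g k 2 t

namespace Separable

variable {ι E : Type*} [Fintype ι] [NormedAddCommGroup E] [NormedSpace ℝ E]
  {F : E → ℝ} {ℓ : ι → E →L[ℝ] ℝ} {U : ι → Set ℝ} {g : ι → ℕ → ℝ → ℝ}

/-- The domain on which all the arguments `ℓ k v` are in `U k`. -/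
def domain (ℓ : ι → E →L[ℝ] ℝ) (U : ι → Set ℝ) : Set E := {v | ∀ k, ℓ k v ∈ U k}

theorem isOpen_domain (hF : Separable F ℓ U g) : IsOpen (domain ℓ U) := by
  have : domain ℓ U = ⋂ k, ℓ k ⁻¹' U k := by ext; simp [domain]
  rw [this]
  exact isOpen_iInter_of_finite fun k => (hF.isOpen k).preimage (ℓ k).continuous

theorem convex_domain (hF : Separable F ℓ U g) : Convex ℝ (domain ℓ U) := by
  have : domain ℓ U = ⋂ k, ℓ k ⁻¹' U k := by ext; simp [domain]
  rw [this]
  exact convex_iInter fun k => (hF.convex k).linear_preimage (ℓ k).toLinearMap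

theorem hasFDerivAt_sum (hF : Separable F ℓ U g) {v : E} (hv : v ∈ domain ℓ U) {j : ℕ} (hj : j < 3)
    (w : ι → ℝ) :
    HasFDerivAt (fun v => ∑ k, g k j (ℓ k v) * w k)
      (∑ k, (g k (j + 1) (ℓ k v) * w k) • ℓ k) v := by
  refine HasFDerivAt.fun_sum fun k _ => ?_
  have h := ((hF.hasDerivAt k j hj _ (hv k)).comp_hasFDerivAt v (ℓ k).hasFDerivAt).mul_const (w k)
  refine h.congr_fderiv ?_
  rw [smul_smul, mul_comm]

theorem hasFDerivAt (hF : Separable F ℓ U g) {v : E} (hv : v ∈ domain ℓ U) :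
    HasFDerivAt F (∑ k, g k 1 (ℓ k v) • ℓ k) v := by
  have h := hF.hasFDerivAt_sum hv (j := 0) (by norm_num) 1
  simp only [Pi.one_apply, mul_one] at h
  exact h.congr_of_eventuallyEq (Eventually.of_forall hF.eq_sum)

theorem fderiv_apply (hF : Separable F ℓ U g) {v : E} (hv : v ∈ domain ℓ U) (u : E) :
    fderiv ℝ F v u = ∑ k, g k 1 (ℓ k v) * ℓ k u := by
  simp [(hF.hasFDerivAt hv).fderiv]

theorem contDiffOn (hF : Separable F ℓ U g) : ContDiffOn ℝ 3 F (domain ℓ U) := by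
  -- Regularity is built from the top: the third derivative is continuous, and each antiderivative
  -- gains one order.
  have key : ∀ n : ℕ, n ≤ 3 → ∀ k, ContDiffOn ℝ n (g k (3 - n)) (U k) := by
    intro n
    induction n with
    | zero => exact fun _ k => contDiffOn_zero.2 (hF.continuousOn k)
    | succ n ih =>
      intro hn k
      have hd := hF.hasDerivAt k (3 - (n + 1)) (by omega)
      rw [show 3 - (n + 1) + 1 = 3 - n by omega] at hd
      rw [Nat.cast_add, Nat.cast_one]
      exact (contDiffOn_succ_iff_deriv_of_isOpen (hF.isOpen k)).2
        ⟨fun t ht => (hd t ht).differentiableAt.differentiableWithinAt, by simp,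
          (ih (by omega) k).congr fun t ht => (hd t ht).deriv⟩
  have : F = fun v => ∑ k, g k 0 (ℓ k v) := funext hF.eq_sum
  rw [this]
  exact ContDiffOn.sum fun k _ => (key 3 le_rfl k).comp (ℓ k).contDiff.contDiffOn
    fun v (hv : v ∈ domain ℓ U) => hv k

theorem iteratedFDeriv_two (hF : Separable F ℓ U g) {v : E} (hv : v ∈ domain ℓ U) (u w : E) :
    iteratedFDeriv ℝ 2 F v ![u, w] = ∑ k, g k 2 (ℓ k v) * (ℓ k u * ℓ k w) := by
  have hd : DifferentiableAt ℝ (iteratedFDeriv ℝ 1 F) v :=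
    (hF.contDiffOn.contDiffAt (hF.isOpen_domain.mem_nhds hv)).differentiableAt_iteratedFDeriv
      (by norm_num)
  rw [hd.iteratedFDeriv_succ_apply_left']
  have h : (fun y => iteratedFDeriv ℝ 1 F y (Fin.tail ![u, w]))
      =ᶠ[𝓝 v] fun y => ∑ k, g k 1 (ℓ k y) * ℓ k w := by
    filter_upwards [hF.isOpen_domain.mem_nhds hv] with y hy
    rw [iteratedFDeriv_one_apply]
    exact hF.fderiv_apply hy w
  rw [h.fderiv_eq, (hF.hasFDerivAt_sum hv (by norm_num) _).fderiv]
  simp only [_root_.sum_apply, _root_.smul_apply, smul_eq_mul]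
  exact Finset.sum_congr rfl fun k _ => by simp; ring

theorem iteratedFDeriv_three (hF : Separable F ℓ U g) {v : E} (hv : v ∈ domain ℓ U) (u : E) :
    iteratedFDeriv ℝ 3 F v ![u, u, u] = ∑ k, g k 3 (ℓ k v) * ℓ k u ^ 3 := by
  have hd : DifferentiableAt ℝ (iteratedFDeriv ℝ 2 F) v :=
    (hF.contDiffOn.contDiffAt (hF.isOpen_domain.mem_nhds hv)).differentiableAt_iteratedFDeriv
      (by norm_num)
  rw [hd.iteratedFDeriv_succ_apply_left']
  have h : (fun y => iteratedFDeriv ℝ 2 F y (Fin.tail ![u, u, u]))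
      =ᶠ[𝓝 v] fun y => ∑ k, g k 2 (ℓ k y) * (ℓ k u * ℓ k u) := by
    filter_upwards [hF.isOpen_domain.mem_nhds hv] with y hy
    exact hF.iteratedFDeriv_two hy u u
  rw [h.fderiv_eq, (hF.hasFDerivAt_sum hv (by norm_num) _).fderiv]
  simp only [_root_.sum_apply, _root_.smul_apply, smul_eq_mul]
  exact Finset.sum_congr rfl fun k _ => by simp; ring

theorem convexOn (hF : Separable F ℓ U g) : ConvexOn ℝ (domain ℓ U) F := by
  have h : ∀ k, ConvexOn ℝ (domain ℓ U) (fun v => g k 0 (ℓ k v)) := fun k => by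
    have h1 : ConvexOn ℝ (U k) (g k 0) := by
      refine convexOn_of_hasDerivWithinAt2_nonneg (f' := g k 1) (f'' := g k 2) (hF.convex k)
        (fun t ht => (hF.hasDerivAt k 0 (by norm_num) t ht).continuousAt.continuousWithinAt)
        ?_ ?_ ?_ <;> intro t ht <;> rw [(hF.isOpen k).interior_eq] at ht
      · exact (hF.hasDerivAt k 0 (by norm_num) t ht).hasDerivWithinAt
      · exact (hF.hasDerivAt k 1 (by norm_num) t ht).hasDerivWithinAt
      · exact hF.nonneg k t ht
    exact (h1.comp_linearMap (ℓ k).toLinearMap).subset (fun v hv => hv k) hF.convex_domain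
  refine ⟨hF.convex_domain, fun x hx y hy a b ha hb hab => ?_⟩
  simp only [hF.eq_sum, smul_eq_mul, Finset.mul_sum, ← Finset.sum_add_distrib]
  exact Finset.sum_le_sum fun k _ => (h k).2 hx hy ha hb hab

/-- With `x_k = g_k'' (ℓ_k u)²` and `T = ∑ x_k`, the one-variable bounds leave `∑ x_k^{3/2}`, and
`x_k^{3/2} ≤ x_k T^{1/2}` sums to `T^{3/2}`. No constant is lost. -/
theorem isSelfConcordantOn [FiniteDimensional ℝ E] (hF : Separable F ℓ U g)
    (hne : (domain ℓ U).Nonempty) {a : ℝ} (ha : 0 < a)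
    (hb : ∀ k, ∀ t ∈ U k, |g k 3 t| ≤ 2 * a ^ (-(1 / 2) : ℝ) * g k 2 t ^ (3 / 2 : ℝ)) :
    IsSelfConcordantOn (domain ℓ U) F a where
  param_pos := ha
  isOpen := hF.isOpen_domain
  nonempty := hne
  convex := hF.convex_domain
  contDiffOn := hF.contDiffOn
  convexOn := hF.convexOn
  bound v hv u := by
    rw [hF.iteratedFDeriv_two hv, hF.iteratedFDeriv_three hv]
    set T := ∑ k, g k 2 (ℓ k v) * (ℓ k u * ℓ k u) with hT
    have ha' : (0 : ℝ) ≤ 2 * a ^ (-(1 / 2) : ℝ) := by positivity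
    have h0 : ∀ k, 0 ≤ g k 2 (ℓ k v) * (ℓ k u * ℓ k u) := fun k =>
      mul_nonneg (hF.nonneg k _ (hv k)) (mul_self_nonneg _)
    have hT0 : 0 ≤ T := Finset.sum_nonneg fun k _ => h0 k
    have hsplit : ∀ x : ℝ, 0 ≤ x → x ^ (3 / 2 : ℝ) = x * x ^ (1 / 2 : ℝ) := fun x hx => by
      rw [show (3 / 2 : ℝ) = 1 + 1 / 2 by norm_num, Real.rpow_add' hx (by norm_num), Real.rpow_one]
    have hterm : ∀ k, |g k 3 (ℓ k v) * ℓ k u ^ 3| ≤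
        2 * a ^ (-(1 / 2) : ℝ) * (g k 2 (ℓ k v) * (ℓ k u * ℓ k u) * T ^ (1 / 2 : ℝ)) := fun k => by
      have h1 : (g k 2 (ℓ k v) * (ℓ k u * ℓ k u)) ^ (3 / 2 : ℝ)
          ≤ g k 2 (ℓ k v) * (ℓ k u * ℓ k u) * T ^ (1 / 2 : ℝ) := by
        rw [hsplit _ (h0 k)]
        exact mul_le_mul_of_nonneg_left (Real.rpow_le_rpow (h0 k)
          (Finset.single_le_sum (fun k _ => h0 k) (Finset.mem_univ k)) (by norm_num)) (h0 k)
      have h2 : |ℓ k u| ^ 3 = (ℓ k u * ℓ k u) ^ (3 / 2 : ℝ) := by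
        rw [← abs_mul_abs_self, ← sq, ← Real.rpow_natCast _ 2, ← Real.rpow_mul (abs_nonneg _),
          ← Real.rpow_natCast _ 3]
        norm_num
      rw [abs_mul, abs_pow, h2]
      calc _ ≤ 2 * a ^ (-(1 / 2) : ℝ) * g k 2 (ℓ k v) ^ (3 / 2 : ℝ)
              * (ℓ k u * ℓ k u) ^ (3 / 2 : ℝ) :=
            mul_le_mul_of_nonneg_right (hb k _ (hv k)) (Real.rpow_nonneg (mul_self_nonneg _) _)
        _ = 2 * a ^ (-(1 / 2) : ℝ) * (g k 2 (ℓ k v) * (ℓ k u * ℓ k u)) ^ (3 / 2 : ℝ) := by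
            rw [Real.mul_rpow (hF.nonneg k _ (hv k)) (mul_self_nonneg _), mul_assoc]
        _ ≤ _ := mul_le_mul_of_nonneg_left h1 ha'
    calc _ ≤ ∑ k, |g k 3 (ℓ k v) * ℓ k u ^ 3| := Finset.abs_sum_le_sum_abs _ _
      _ ≤ _ := Finset.sum_le_sum fun k _ => hterm k
      _ = _ := by rw [← Finset.mul_sum, ← Finset.sum_mul, hsplit _ hT0]

end Separable

/-! ### One-variable estimates for the cell and node terms -/

/-- The function of one cell in the discrete functional, and its first three derivatives. -/
def cellFun (h f p α β : ℝ) : ℕ → ℝ → ℝ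
  | 0, s => h * (f * primG s p + α * (s ^ 2 / 2 - s * p) + β * (-Real.log (1 + s) + s / p))
  | 1, s => h * (-(f * kernelInt 0 p (1 + s)) + α * (s - p) + β * (-(1 + s)⁻¹ + 1 / p))
  | 2, s => h * (f * kernelInt 1 p (1 + s) + α + β * ((1 + s) ^ 2)⁻¹)
  | 3, s => h * (-(2 * (f * kernelInt 2 p (1 + s))) - 2 * β * ((1 + s) ^ 3)⁻¹)
  | _, _ => 0

/-- The function `t ↦ κ (t - b)² / 2` and its derivatives. -/
def nodeFun (κ b : ℝ) : ℕ → ℝ → ℝ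
  | 0, t => κ * (t - b) ^ 2 / 2
  | 1, t => κ * (t - b)
  | 2, _ => κ
  | _, _ => 0

theorem hasDerivAt_nodeFun (κ b : ℝ) {j : ℕ} (hj : j < 3) (t : ℝ) :
    HasDerivAt (nodeFun κ b j) (nodeFun κ b (j + 1) t) t := by
  have h : HasDerivAt (fun t => t - b) 1 t := (hasDerivAt_id t).sub_const b
  interval_cases j
  · refine (((h.fun_pow 2).const_mul κ).div_const 2).congr_deriv ?_
    simp only [nodeFun]; push_cast; ring
  · exact (h.const_mul κ).congr_deriv (mul_one κ)
  · exact hasDerivAt_const t κ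

section cell

variable {h f p α β s : ℝ}

theorem hasDerivAt_cellFun (hp : 0 < p) (hs : -1 < s) {j : ℕ} (hj : j < 3) :
    HasDerivAt (cellFun h f p α β j) (cellFun h f p α β (j + 1) s) s := by
  have hy : 0 < 1 + s := by linarith
  have h1 : HasDerivAt (fun s : ℝ => 1 + s) 1 s := (hasDerivAt_id s).const_add 1
  have hid : HasDerivAt (fun s : ℝ => s) 1 s := hasDerivAt_id s
  have hK : ∀ k, HasDerivAt (fun s => kernelInt k p (1 + s))
      (-(k + 1) * kernelInt (k + 1) p (1 + s)) s := fun k => by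
    exact ((hasDerivAt_kernelInt k hp hy).comp s h1).congr_deriv (mul_one _)
  interval_cases j
  · refine (((((hasDerivAt_primG hp hs).const_mul f).fun_add
      ((((hid.fun_pow 2).div_const 2).fun_sub (hid.mul_const p)).const_mul α)).fun_add
      (((h1.log hy.ne').fun_neg.fun_add (hid.div_const p)).const_mul β)).const_mul h).congr_deriv ?_
    simp only [cellFun]; push_cast; ring
  · refine (((((hK 0).const_mul f).fun_neg.fun_add ((hid.sub_const p).const_mul α)).fun_add
      (((h1.fun_inv hy.ne').fun_neg.add_const (1 / p)).const_mul β)).const_mul h).congr_deriv ?_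
    simp only [cellFun]; push_cast; ring
  · refine (((((hK 1).const_mul f).add_const α).fun_add
      (((h1.fun_pow 2).fun_inv (pow_ne_zero 2 hy.ne')).const_mul β)).const_mul h).congr_deriv ?_
    simp only [cellFun]; push_cast; field_simp; ring

theorem continuousOn_cellFun_three (hp : 0 < p) : ContinuousOn (cellFun h f p α β 3) (Ioi (-1)) := by
  have hpos : ∀ s ∈ Ioi (-1 : ℝ), 1 + s ∈ Ioi (0 : ℝ) := fun s (hs : -1 < s) => by
    show 0 < 1 + s; linarith
  have hK : ContinuousOn (fun s => kernelInt 2 p (1 + s)) (Ioi (-1)) :=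
    ((contDiffOn_kernelInt 0 2 hp).continuousOn).comp (by fun_prop) hpos
  have hI : ContinuousOn (fun s : ℝ => ((1 + s) ^ 3)⁻¹) (Ioi (-1)) :=
    ContinuousOn.inv₀ (by fun_prop) fun s hs => pow_ne_zero _ (ne_of_gt (hpos s hs))
  exact continuousOn_const.mul (((hK.const_mul f).const_mul 2).neg.sub (hI.const_mul (2 * β)))

variable (hh : 0 < h) (hf : 0 < f) (hp : 0 < p) (hα : 0 ≤ α) (hs : -1 < s)
include hh hf hp hα hs

/-- The logarithmic barrier alone accounts for this bound; the other two contributions are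
nonnegative. -/
theorem le_cellFun_two : h * β * ((1 + s) ^ 2)⁻¹ ≤ cellFun h f p α β 2 s := by
  have := mul_nonneg hf.le (kernelInt_nonneg 1 hp (by linarith : 0 < 1 + s))
  rw [cellFun, mul_assoc]
  gcongr
  linarith

variable (hβ : 0 < β)
include hβ

theorem cellFun_two_pos : 0 < cellFun h f p α β 2 s := by
  have : 0 < 1 + s := by linarith
  exact lt_of_lt_of_le (by positivity) (le_cellFun_two hh hf hp hα hs)

theorem abs_cellFun_three_le :
    |cellFun h f p α β 3 s| ≤ 2 / (1 + s) * cellFun h f p α β 2 s := by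
  have hy : 0 < 1 + s := by linarith
  have h2 := kernelInt_two_le hp hy
  have h0 := kernelInt_nonneg 2 hp hy
  have h1 : f * kernelInt 2 p (1 + s) ≤ f * kernelInt 1 p (1 + s) / (1 + s) := by
    rw [mul_div_assoc]; gcongr
  have h3 : 0 ≤ α / (1 + s) := by positivity
  rw [cellFun, cellFun, abs_mul, abs_of_pos hh]
  have h4 : 0 ≤ 2 * (f * kernelInt 2 p (1 + s)) := by positivity
  have h5 : 0 ≤ 2 * β * ((1 + s) ^ 3)⁻¹ := by positivity
  rw [abs_of_nonpos (by linarith)]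
  have h6 : 2 / (1 + s) * (h * (f * kernelInt 1 p (1 + s) + α + β * ((1 + s) ^ 2)⁻¹))
      = h * (2 * (f * kernelInt 1 p (1 + s) / (1 + s)) + 2 * (α / (1 + s))
        + 2 * β * ((1 + s) ^ 3)⁻¹) := by field_simp
  rw [h6]
  gcongr
  linarith

/-- The factor `1/(1+s)` in the preceding bound is at most `a^{-1/2} (φ'')^{1/2}`, because the
barrier gives `φ'' ≥ a/(1+s)²`. -/
theorem abs_cellFun_three_le_rpow {a : ℝ} (ha : 0 < a) (hab : a ≤ h * β) :
    |cellFun h f p α β 3 s|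
      ≤ 2 * a ^ (-(1 / 2) : ℝ) * cellFun h f p α β 2 s ^ (3 / 2 : ℝ) := by
  have hy : 0 < 1 + s := by linarith
  have hpos := cellFun_two_pos hh hf hp hα hs hβ
  refine (abs_cellFun_three_le hh hf hp hα hs hβ).trans ?_
  have hle := le_cellFun_two (β := β) hh hf hp hα hs
  set φ := cellFun h f p α β 2 s
  have h1 : (1 + s)⁻¹ ≤ a ^ (-(1 / 2) : ℝ) * φ ^ (1 / 2 : ℝ) := by
    have : a * ((1 + s)⁻¹) ^ 2 ≤ φ := by
      rw [inv_pow]; exact (mul_le_mul_of_nonneg_right hab (by positivity)).trans hle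
    have h2 := Real.rpow_le_rpow (by positivity) this (by norm_num : (0 : ℝ) ≤ 1 / 2)
    rw [Real.mul_rpow ha.le (by positivity), ← Real.sqrt_eq_rpow (_ ^ 2),
      Real.sqrt_sq (by positivity)] at h2
    rw [Real.rpow_neg ha.le, ← div_eq_inv_mul, le_div_iff₀' (by positivity)]
    exact h2
  rw [show (3 / 2 : ℝ) = 1 / 2 + 1 by norm_num, Real.rpow_add hpos, Real.rpow_one]
  calc 2 / (1 + s) * φ = 2 * (1 + s)⁻¹ * φ := by ring
    _ ≤ 2 * (a ^ (-(1 / 2) : ℝ) * φ ^ (1 / 2 : ℝ)) * φ := by gcongr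
    _ = _ := by ring

theorem cellFun_two_le_of_le {r t : ℝ} (hr0 : 0 ≤ r) (hr : r < 1)
    (ht : (1 - r) * (1 + s) ≤ 1 + t) :
    cellFun h f p α β 2 t ≤ cellFun h f p α β 2 s / (1 - r) ^ 2 := by
  have hy : 0 < 1 + s := by linarith
  have hr1 : 0 < 1 - r := by linarith
  have h1 := kernelInt_one_le_of_le hp hy hr0 hr ht
  have h2 : α ≤ α / (1 - r) ^ 2 := le_div_self hα (by positivity) (pow_le_one₀ hr1.le (by linarith))
  have h3 : ((1 + t) ^ 2)⁻¹ ≤ ((1 + s) ^ 2)⁻¹ / (1 - r) ^ 2 := by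
    rw [← one_div, ← one_div, div_div, ← mul_pow, mul_comm (1 + s)]
    gcongr
  simp only [cellFun]
  calc _ ≤ h * (f * (kernelInt 1 p (1 + s) / (1 - r) ^ 2) + α / (1 - r) ^ 2
        + β * (((1 + s) ^ 2)⁻¹ / (1 - r) ^ 2)) := by gcongr
    _ = _ := by ring

/-- A barrier bound for the function of one cell. -/
theorem le_cellFun_zero :
    h * (-(f * (kernelInt 0 p 1 * |s|)) - α * (|s| * p) - β * Real.log (1 + s) - β * (|s| / p))
      ≤ cellFun h f p α β 0 s := by
  have h1 := neg_mul_kernelInt_le_primG hp hs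
  have h2 : kernelInt 0 p 1 * s ≤ kernelInt 0 p 1 * |s| :=
    mul_le_mul_of_nonneg_left (le_abs_self s) (kernelInt_nonneg 0 hp one_pos)
  have h3 : -(f * (kernelInt 0 p 1 * |s|)) ≤ f * primG s p := by
    rw [← mul_neg]; exact mul_le_mul_of_nonneg_left (by linarith) hf.le
  have h4 : -(α * (|s| * p)) ≤ α * (s ^ 2 / 2 - s * p) := by
    rw [← mul_neg]
    have := mul_le_mul_of_nonneg_right (le_abs_self s) hp.le
    exact mul_le_mul_of_nonneg_left (by nlinarith [sq_nonneg s]) hα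
  have h5 : -(β * (|s| / p)) ≤ β * (s / p) := by
    rw [← mul_neg, ← neg_div]
    have := neg_abs_le s
    gcongr
  simp only [cellFun]
  gcongr
  linarith

end cell

/-! ### Extension by zero to the boundary nodes -/

section extZero

variable {N : ℕ}

@[simp] theorem extZero_zero (v : Fin N → ℝ) : extZero v 0 = 0 := rfl

@[simp] theorem extZero_last (v : Fin N → ℝ) : extZero v (Fin.last (N + 1)) = 0 := by
  rw [← Fin.succ_last, extZero, Fin.cons_succ, Fin.snoc_last]

@[simp] theorem extZero_interiorIdx (v : Fin N → ℝ) (j : Fin N) :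
    extZero v (interiorIdx j) = v j := by
  rw [interiorIdx, extZero, Fin.cons_succ, Fin.snoc_castSucc]

theorem node_ext {l l' : Fin (N + 2) → ℝ} (h0 : l 0 = l' 0)
    (hlast : l (Fin.last (N + 1)) = l' (Fin.last (N + 1)))
    (hint : ∀ j, l (interiorIdx j) = l' (interiorIdx j)) : l = l' := by
  funext i
  refine Fin.cases h0 (fun i => ?_) i
  refine Fin.lastCases ?_ (fun j => hint j) i
  rw [Fin.succ_last]
  exact hlast

theorem extZero_add (v w : Fin N → ℝ) : extZero (v + w) = extZero v + extZero w :=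
  node_ext (by simp) (by simp) (by simp)

theorem extZero_smul (c : ℝ) (v : Fin N → ℝ) : extZero (c • v) = c • extZero v :=
  node_ext (by simp) (by simp) (by simp)

end extZero

/-! ### The functional in separable form, its gradient and its Hessian -/

namespace StepData

variable {N : ℕ} (P : StepData N)

/-- The assumptions on the data of one time step. -/
structure Admissible : Prop where
  L_pos : 0 < P.L
  τ_pos : 0 < P.τ
  m_pos : 0 < P.m
  A₀_nonneg : 0 ≤ P.A₀
  f₀_pos : ∀ X ∈ Icc P.X₀ (P.X₀ + P.L), 0 < P.f₀ X
  xn_mem : P.xn ∈ P.Q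

/-- `D_h x̂` in one cell as a linear form in the interior values of `x̂`. -/
def slope (i : Fin (N + 1)) : (Fin N → ℝ) →L[ℝ] ℝ :=
  LinearMap.toContinuousLinearMap
    { toFun := fun v => P.Dh (extZero v) i
      map_add' := fun v w => by simp only [Dh, extZero_add, Pi.add_apply]; ring
      map_smul' := fun c v => by
        simp only [Dh, extZero_smul, Pi.smul_apply, smul_eq_mul, RingHom.id_apply]; ring }

theorem slope_apply (i : Fin (N + 1)) (v : Fin N → ℝ) : P.slope i v = P.Dh (extZero v) i := rfl

/-- The linear forms of the functional `F`: one for each cell and one for each interior node. -/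
def form : Fin (N + 1) ⊕ Fin N → (Fin N → ℝ) →L[ℝ] ℝ :=
  Sum.elim P.slope fun j => ContinuousLinearMap.proj j

/-- The domains of the one-dimensional terms of the functional `F`. -/
def termDomain (_P : StepData N) : Fin (N + 1) ⊕ Fin N → Set ℝ :=
  Sum.elim (fun _ => Ioi (-1)) fun _ => univ

/-- The one-dimensional terms of the functional `F`, with their derivatives. -/
def term : Fin (N + 1) ⊕ Fin N → ℕ → ℝ → ℝ :=
  Sum.elim (fun i => cellFun P.h (P.fMid i) (P.Dh P.xn i) (P.A₀ * P.τ) (P.τ ^ 2))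
    fun j => nodeFun (P.h * P.coeff j / P.τ) (P.xn (interiorIdx j) - P.grid (interiorIdx j))

theorem grid_succ_sub (i : Fin (N + 1)) : P.grid i.succ - P.grid i.castSucc = P.h := by
  simp only [grid, pos, Fin.val_succ, Fin.val_castSucc]
  push_cast
  ring

theorem grid_zero : P.grid 0 = P.X₀ := by simp [grid, pos]

theorem grid_last : P.grid (Fin.last (N + 1)) = P.X₀ + P.L := by
  have : (N : ℝ) + 1 ≠ 0 := by positivity
  simp only [grid, pos, Fin.val_last, h]
  push_cast
  field_simp

/-- By summation by parts, `d_h` is the negative adjoint of `D_h` on functions vanishing at the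
boundary. -/
theorem sum_mul_Dh_extZero (ψ : Fin (N + 1) → ℝ) (u : Fin N → ℝ) :
    ∑ i, ψ i * P.Dh (extZero u) i = -∑ j, P.dh ψ j * u j := by
  have h1 : ∑ i, ψ i * extZero u i.succ = ∑ j : Fin N, ψ j.castSucc * u j := by
    rw [Fin.sum_univ_castSucc]
    simp only [Fin.succ_last, extZero_last, mul_zero, add_zero]
    exact Finset.sum_congr rfl fun j _ => by rw [← interiorIdx, extZero_interiorIdx]
  have h2 : ∑ i : Fin (N + 1), ψ i * extZero u i.castSucc = ∑ j : Fin N, ψ j.succ * u j := by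
    rw [Fin.sum_univ_succ]
    simp only [Fin.castSucc_zero, extZero_zero, mul_zero, zero_add]
    exact Finset.sum_congr rfl fun j _ => by
      rw [← Fin.succ_castSucc, ← interiorIdx, extZero_interiorIdx]
  have h3 : ∑ i, ψ i * P.Dh (extZero u) i
      = (∑ i, ψ i * extZero u i.succ - ∑ i : Fin (N + 1), ψ i * extZero u i.castSucc) / P.h := by
    rw [← Finset.sum_sub_distrib, Finset.sum_div]
    exact Finset.sum_congr rfl fun i _ => by rw [Dh]; ring
  rw [h3, h1, h2, ← Finset.sum_sub_distrib, Finset.sum_div, ← Finset.sum_neg_distrib]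
  exact Finset.sum_congr rfl fun i _ => by rw [dh]; ring

theorem sum_Dh_extZero (u : Fin N → ℝ) : ∑ i, P.Dh (extZero u) i = 0 := by
  simpa [dh] using P.sum_mul_Dh_extZero (fun _ => 1) u

theorem F_eq_sum (v : Fin N → ℝ) : P.F v = ∑ k, P.term k 0 (P.form k v) := by
  rw [Fintype.sum_sum_type]
  simp only [F, F₁, F₂, F₃, F₄, innerMid, term, form, Sum.elim_inl, Sum.elim_inr, cellFun, nodeFun,
    slope_apply, ContinuousLinearMap.proj_apply, mul_one]
  have h1 : 1 / (2 * P.τ) * (P.h * ∑ j : Fin N,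
      P.coeff j * (P.grid (interiorIdx j) + v j - P.xn (interiorIdx j)) ^ 2)
      = ∑ j : Fin N, P.h * P.coeff j / P.τ
        * (v j - (P.xn (interiorIdx j) - P.grid (interiorIdx j))) ^ 2 / 2 := by
    simp only [Finset.mul_sum]
    exact Finset.sum_congr rfl fun j _ => by ring
  rw [h1, add_assoc, add_assoc, add_comm]
  congr 1
  simp only [Finset.mul_sum, ← Finset.sum_sub_distrib, ← Finset.sum_add_distrib,
    ← Finset.sum_neg_distrib]
  exact Finset.sum_congr rfl fun i _ => by ring

theorem mul_h : ((N : ℝ) + 1) * P.h = P.L := by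
  have : (N : ℝ) + 1 ≠ 0 := by positivity
  rw [h]; field_simp

theorem minf_le : P.minf ≤ P.f₀ P.X₀ := by
  have := Finset.inf'_le P.fNode (Finset.mem_univ (0 : Fin (N + 2)))
  rwa [fNode, grid_zero] at this

theorem grid_add_extZero_hat {x : Fin (N + 2) → ℝ} (hx : x ∈ P.Q) :
    P.grid + extZero (P.hat x) = x := by
  refine node_ext ?_ ?_ fun j => ?_
  · simp [grid_zero, hx.2.1]
  · simp [grid_last, hx.2.2]
  · simp [hat]

theorem hat_grid_add_extZero (v : Fin N → ℝ) : P.hat (P.grid + extZero v) = v := by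
  funext j; simp [hat]

theorem hat_mem {x : Fin (N + 2) → ℝ} (hx : x ∈ P.Q) : P.hat x ∈ P.hatQ := by
  rw [hatQ, mem_ofPred_eq, P.grid_add_extZero_hat hx]
  exact hx

variable {P} (hP : P.Admissible)
include hP

namespace Admissible

theorem h_pos : 0 < P.h := div_pos hP.L_pos (by positivity)

theorem pos_mem {r : ℝ} (h0 : 0 ≤ r) (h1 : r ≤ N + 1) : P.pos r ∈ Icc P.X₀ (P.X₀ + P.L) := by
  have hh := hP.h_pos
  rw [← P.mul_h]
  exact ⟨by rw [pos]; nlinarith, by rw [pos]; nlinarith⟩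

theorem fMid_pos (i : Fin (N + 1)) : 0 < P.fMid i := by
  have hi : ((i : ℕ) : ℝ) ≤ N := by exact_mod_cast Nat.lt_succ_iff.1 i.2
  exact hP.f₀_pos _ (hP.pos_mem (by positivity) (by linarith))

theorem fNode_pos (i : Fin (N + 2)) : 0 < P.fNode i := by
  have hi : ((i : ℕ) : ℝ) ≤ N + 1 := by exact_mod_cast Nat.lt_succ_iff.1 i.2
  exact hP.f₀_pos _ (hP.pos_mem (by positivity) hi)

theorem minf_pos : 0 < P.minf := by
  rw [minf, Finset.lt_inf'_iff]
  exact fun i _ => hP.fNode_pos i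

/-- The cut-off at `τ²` suffices, whatever the sign of the extrapolated slope. -/
theorem S_pos (j : Fin N) : 0 < P.S j := lt_max_of_lt_right (pow_pos hP.τ_pos 2)

theorem coeff_pos (j : Fin N) : 0 < P.coeff j :=
  div_pos (hP.fNode_pos _) (mul_pos hP.m_pos
    (Real.rpow_pos_of_pos (div_pos (hP.fNode_pos _) (hP.S_pos j)) _))

theorem weight_pos (j : Fin N) : 0 < P.h * P.coeff j / P.τ :=
  div_pos (mul_pos hP.h_pos (hP.coeff_pos j)) hP.τ_pos

theorem Dh_pos {x : Fin (N + 2) → ℝ} (hx : x ∈ P.Q) (i : Fin (N + 1)) : 0 < P.Dh x i :=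
  div_pos (sub_pos.2 (hx.1 i)) hP.h_pos

theorem Dh_grid_add (e : Fin (N + 2) → ℝ) (i : Fin (N + 1)) :
    P.Dh (P.grid + e) i = 1 + P.Dh e i := by
  have := hP.h_pos.ne'
  have h1 := P.grid_succ_sub i
  simp only [Dh, Pi.add_apply]
  field_simp
  linarith

theorem mem_hatQ {v : Fin N → ℝ} : v ∈ P.hatQ ↔ ∀ i, -1 < P.slope i v := by
  have key : ∀ i : Fin (N + 1), (P.grid + extZero v) i.castSucc < (P.grid + extZero v) i.succ
      ↔ -1 < P.slope i v := fun i => by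
    have h1 := hP.Dh_grid_add (extZero v) i
    rw [slope_apply, ← sub_pos, ← div_pos_iff_of_pos_right hP.h_pos, ← Dh, h1]
    constructor <;> intro h <;> linarith
  simp only [hatQ, Q, mem_ofPred_eq, key]
  simp [grid_zero, grid_last]

theorem hatQ_eq : P.hatQ = Separable.domain P.form P.termDomain := by
  ext v
  rw [hP.mem_hatQ]
  simp [Separable.domain, form, termDomain]

theorem A₀τ_nonneg : 0 ≤ P.A₀ * P.τ := mul_nonneg hP.A₀_nonneg hP.τ_pos.le

theorem term_two_pos {k : Fin (N + 1) ⊕ Fin N} {t : ℝ} (ht : t ∈ P.termDomain k) :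
    0 < P.term k 2 t := by
  rcases k with i | j
  · exact cellFun_two_pos hP.h_pos (hP.fMid_pos i) (hP.Dh_pos hP.xn_mem i) hP.A₀τ_nonneg ht
      (pow_pos hP.τ_pos 2)
  · exact hP.weight_pos j

theorem separable : Separable P.F P.form P.termDomain P.term where
  eq_sum := P.F_eq_sum
  isOpen k := by
    rcases k with i | j
    exacts [isOpen_Ioi, isOpen_univ]
  convex k := by
    rcases k with i | j
    exacts [convex_Ioi _, convex_univ]
  hasDerivAt k j hj t ht := by
    rcases k with i | i
    · exact hasDerivAt_cellFun (hP.Dh_pos hP.xn_mem i) ht hj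
    · exact hasDerivAt_nodeFun _ _ hj t
  continuousOn k := by
    rcases k with i | i
    · exact continuousOn_cellFun_three (α := P.A₀ * P.τ) (hP.Dh_pos hP.xn_mem i)
    · exact continuousOn_const
  nonneg k t ht := (hP.term_two_pos ht).le

theorem isSelfConcordantOn {a : ℝ} (ha : 0 < a) (hle : a ≤ P.h * P.τ ^ 2) :
    IsSelfConcordantOn P.hatQ P.F a := by
  have hne : P.hatQ.Nonempty := ⟨_, P.hat_mem hP.xn_mem⟩
  rw [hP.hatQ_eq] at hne ⊢
  refine hP.separable.isSelfConcordantOn hne ha fun k t ht => ?_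
  rcases k with i | j
  · exact abs_cellFun_three_le_rpow hP.h_pos (hP.fMid_pos i) (hP.Dh_pos hP.xn_mem i) hP.A₀τ_nonneg
      ht (pow_pos hP.τ_pos 2) ha hle
  · have h0 := (hP.term_two_pos ht).le
    have h1 : P.term (Sum.inr j) 3 t = 0 := rfl
    rw [h1, abs_zero]
    positivity

/-- The gradient of `F`, written as the residual of the scheme. -/
theorem fderiv_eq {v : Fin N → ℝ} (hv : v ∈ P.hatQ) (u : Fin N → ℝ) :
    fderiv ℝ P.F v u = P.h * ∑ j, (P.coeff j * (((P.grid + extZero v) (interiorIdx j)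
        - P.xn (interiorIdx j)) / P.τ)
      + P.dh (fun i => P.fMid i * logQuot (P.Dh (P.grid + extZero v) i) (P.Dh P.xn i)
          - P.A₀ * P.τ * P.Dh (P.grid + extZero v - P.xn) i
          + P.τ ^ 2 * (1 / P.Dh (P.grid + extZero v) i - 1 / P.Dh P.xn i)) j) * u j := by
  rw [hP.separable.fderiv_apply (hP.hatQ_eq ▸ hv), Fintype.sum_sum_type]
  simp only [add_mul, Finset.sum_add_distrib]
  rw [← neg_eq_iff_eq_neg.2 (P.sum_mul_Dh_extZero _ u), mul_add, add_comm]
  congr 1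
  · rw [Finset.mul_sum]
    refine Finset.sum_congr rfl fun j _ => ?_
    simp only [term, form, Sum.elim_inr, nodeFun, ContinuousLinearMap.proj_apply, Pi.add_apply,
      extZero_interiorIdx]
    ring
  · have h0 := P.sum_Dh_extZero u
    have h1 : ∀ i, P.term (Sum.inl i) 1 (P.form (Sum.inl i) v) * P.form (Sum.inl i) u
        = -P.h * ((P.fMid i * logQuot (P.Dh (P.grid + extZero v) i) (P.Dh P.xn i)
          - P.A₀ * P.τ * P.Dh (P.grid + extZero v - P.xn) i
          + P.τ ^ 2 * (1 / P.Dh (P.grid + extZero v) i - 1 / P.Dh P.xn i))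
          * P.Dh (extZero u) i) - P.h * (P.A₀ * P.τ) * P.Dh (extZero u) i := fun i => by
      have hs := hP.mem_hatQ.1 hv i
      rw [slope_apply] at hs
      have h2 : P.Dh (P.grid + extZero v - P.xn) i = P.Dh (P.grid + extZero v) i - P.Dh P.xn i := by
        simp only [Dh, Pi.sub_apply]; ring
      rw [h2, hP.Dh_grid_add, logQuot_eq_kernelInt (hP.Dh_pos hP.xn_mem i) (by linarith)]
      simp only [term, form, Sum.elim_inl, cellFun, slope_apply]
      ring
    rw [Finset.sum_congr rfl fun i _ => h1 i, Finset.sum_sub_distrib, ← Finset.mul_sum,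
      ← Finset.mul_sum, h0]
    ring

/-- The Hessian of `F`, written as the operator of the Newton system. -/
theorem iteratedFDeriv_two_eq {v : Fin N → ℝ} (hv : v ∈ P.hatQ) (w u : Fin N → ℝ) :
    iteratedFDeriv ℝ 2 P.F v ![w, u] = P.h * ∑ j, (P.coeff j * (extZero w (interiorIdx j) / P.τ)
      - P.dh (fun i => (-(P.fMid i * logQuotW (P.Dh (P.grid + extZero v) i) (P.Dh P.xn i))
          + P.A₀ * P.τ + P.τ ^ 2 / (P.Dh (P.grid + extZero v) i) ^ 2)
          * P.Dh (extZero w) i) j) * u j := by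
  rw [hP.separable.iteratedFDeriv_two (hP.hatQ_eq ▸ hv), Fintype.sum_sum_type]
  simp only [sub_mul, Finset.sum_sub_distrib]
  rw [sub_eq_add_neg, ← P.sum_mul_Dh_extZero _ u, mul_add, add_comm, Finset.mul_sum,
    Finset.mul_sum]
  congr 1
  · refine Finset.sum_congr rfl fun j _ => ?_
    simp only [term, form, Sum.elim_inr, nodeFun, ContinuousLinearMap.proj_apply,
      extZero_interiorIdx]
    ring
  · refine Finset.sum_congr rfl fun i _ => ?_
    have hs := hP.mem_hatQ.1 hv i
    rw [slope_apply] at hs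
    rw [hP.Dh_grid_add, logQuotW_eq_neg_kernelInt (hP.Dh_pos hP.xn_mem i) (by linarith)]
    simp only [term, form, Sum.elim_inl, cellFun, slope_apply]
    ring

end Admissible
end StepData

/-! ### Taylor's inequality and bounds for the damping factor -/

/-- Taylor's inequality of second order on `[0, t]`. -/
theorem le_quadratic_of_deriv_two_le {q q₁ q₂ : ℝ → ℝ} {t B : ℝ} (ht : 0 ≤ t)
    (h₁ : ∀ s ∈ Icc 0 t, HasDerivAt q (q₁ s) s) (h₂ : ∀ s ∈ Icc 0 t, HasDerivAt q₁ (q₂ s) s)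
    (hB : ∀ s ∈ Icc 0 t, q₂ s ≤ B) : q t ≤ q 0 + q₁ 0 * t + B * t ^ 2 / 2 := by
  have anti : ∀ {f f' : ℝ → ℝ}, (∀ s ∈ Icc 0 t, HasDerivAt f (f' s) s) →
      (∀ s ∈ Icc 0 t, f' s ≤ 0) → AntitoneOn f (Icc 0 t) := fun hf hf' =>
    antitoneOn_of_hasDerivWithinAt_nonpos (convex_Icc _ _)
      (fun s hs => (hf s hs).continuousAt.continuousWithinAt)
      (fun s hs => (hf s (interior_subset hs)).hasDerivWithinAt)
      (fun s hs => hf' s (interior_subset hs))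
  have h0 : (0 : ℝ) ∈ Icc 0 t := ⟨le_rfl, ht⟩
  have hA : AntitoneOn (fun s => q₁ s - B * s) (Icc 0 t) :=
    anti (fun s hs => (h₂ s hs).fun_sub (((hasDerivAt_id s).const_mul B).congr_deriv (mul_one B)))
      fun s hs => sub_nonpos.2 (hB s hs)
  have hA2 : AntitoneOn (fun s => q s - (q₁ 0 * s + B * s ^ 2 / 2)) (Icc 0 t) := by
    refine anti (f' := fun s => q₁ s - (q₁ 0 + B * s)) (fun s hs => (h₁ s hs).fun_sub ?_)
      fun s hs => ?_
    · refine (((hasDerivAt_id s).const_mul (q₁ 0)).fun_add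
        ((((hasDerivAt_id s).fun_pow 2).const_mul B).div_const 2)).congr_deriv ?_
      simp only [id]; push_cast; ring
    · have := hA h0 hs hs.1
      simp only [mul_zero, sub_zero] at this
      linarith
  have := hA2 h0 ⟨ht, le_rfl⟩ ht
  simp only at this
  nlinarith

section damping

variable {lam' lam : ℝ}

theorem two_sub_sqrt_three_pos : 0 < 2 - Real.sqrt 3 := by
  have : Real.sqrt 3 < 2 := by rw [Real.sqrt_lt' (by norm_num)]; norm_num
  linarith

variable (h0 : 2 - Real.sqrt 3 ≤ lam') (h1 : lam' < 1) (hlam : 0 ≤ lam)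
include h0 h1 hlam

theorem dampingFactor_pos : 0 < dampingFactor lam' lam := by
  have := two_sub_sqrt_three_pos
  unfold dampingFactor
  split_ifs with h2 h3
  · positivity
  · exact div_pos (by linarith) (mul_pos (by linarith) (by linarith))
  · exact one_pos

theorem dampingFactor_le_one : dampingFactor lam' lam ≤ 1 := by
  have := two_sub_sqrt_three_pos
  unfold dampingFactor
  split_ifs with h2 h3
  · rw [div_le_one (by positivity)]; linarith
  · rw [div_le_one (mul_pos (by linarith) (by linarith))]
    -- The claim is `λ² - 4λ + 1 ≤ 0`, whose smaller root is the threshold `2 - √3`.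
    have h3' : Real.sqrt 3 ^ 2 = 3 := Real.sq_sqrt (by norm_num)
    have h4 : 0 ≤ Real.sqrt 3 := Real.sqrt_nonneg 3
    nlinarith
  · exact le_rfl

theorem dampingFactor_mul_le_one : dampingFactor lam' lam * lam ≤ 1 := by
  have := two_sub_sqrt_three_pos
  have hs : (1 : ℝ) ≤ Real.sqrt 3 := by rw [Real.one_le_sqrt]; norm_num
  unfold dampingFactor
  split_ifs with h2 h3
  · rw [div_mul_eq_mul_div, div_le_one (by positivity)]; linarith
  · have h4 : 0 < lam := by linarith
    rw [div_mul_eq_mul_div, div_le_one (mul_pos h4 (by linarith))]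
    nlinarith
  · push Not at h3; linarith

theorem le_dampingFactor : (1 - lam') / 3 / (1 + lam) ≤ dampingFactor lam' lam := by
  have := two_sub_sqrt_three_pos
  have h5 : (1 - lam') / 3 / (1 + lam) ≤ (1 - lam') / 3 :=
    div_le_self (by linarith) (by linarith)
  unfold dampingFactor
  split_ifs with h2 h3
  · gcongr; linarith
  · have h4 : 0 < lam := by linarith
    refine h5.trans ?_
    rw [div_le_div_iff₀ (by norm_num) (mul_pos h4 (by linarith))]
    nlinarith [mul_nonneg h4.le (sub_nonneg.2 h1.le)]
  · linarith

end damping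

/-- With `q = l²/(1+l)`, the quadratic equation `l² = q(1+l)` forces `l ≤ q + √q`. -/
theorem tendsto_zero_of_sq_div {l : ℕ → ℝ} (h0 : ∀ k, 0 ≤ l k)
    (h : Tendsto (fun k => l k ^ 2 / (1 + l k)) atTop (𝓝 0)) : Tendsto l atTop (𝓝 0) := by
  refine squeeze_zero h0 (fun k => ?_)
    (g := fun k => l k ^ 2 / (1 + l k) + Real.sqrt (l k ^ 2 / (1 + l k))) ?_
  · have h1 := h0 k
    set q := l k ^ 2 / (1 + l k) with hq
    have hq0 : 0 ≤ q := by positivity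
    have h2 : l k ^ 2 = q * (1 + l k) := by rw [hq]; field_simp
    have h3 := Real.sq_sqrt hq0
    have h4 := Real.sqrt_nonneg q
    by_contra! hlt
    nlinarith
  · simpa using h.add h.sqrt

/-! ### Newton direction, decrement and descent -/

namespace StepData

variable {N : ℕ} (P : StepData N)

/-- The quadratic form of the Hessian of `F`, polarized. -/
def hessForm (v u w : Fin N → ℝ) : ℝ :=
  ∑ k, P.term k 2 (P.form k v) * (P.form k u * P.form k w)

/-- The Newton direction in the interior variables. -/
def newtonDir (v : Fin N → ℝ) : Fin N → ℝ := -((P.hess v)⁻¹.mulVec (P.grad v))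

theorem newtonDecrement_nonneg (a : ℝ) (v : Fin N → ℝ) : 0 ≤ P.newtonDecrement a v :=
  Real.sqrt_nonneg _

theorem hessForm_comm (v u w : Fin N → ℝ) : P.hessForm v u w = P.hessForm v w u :=
  Finset.sum_congr rfl fun k _ => by ring

theorem dotProduct_grad (v u : Fin N → ℝ) : P.grad v ⬝ᵥ u = fderiv ℝ P.F v u := by
  have := (fderiv ℝ P.F v).toLinearMap.pi_apply_eq_sum_univ u
  rw [ContinuousLinearMap.coe_coe] at this
  rw [this, dotProduct]
  refine Finset.sum_congr rfl fun j _ => ?_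
  rw [smul_eq_mul, mul_comm, grad]
  congr 2
  ext i
  simp [Pi.single_apply, eq_comm]

variable {P} (hP : P.Admissible)
include hP

namespace Admissible

theorem form_mem {v : Fin N → ℝ} (hv : v ∈ P.hatQ) (k) : P.form k v ∈ P.termDomain k := by
  rw [hP.hatQ_eq] at hv; exact hv k

theorem dotProduct_hess {v : Fin N → ℝ} (hv : v ∈ P.hatQ) (u w : Fin N → ℝ) :
    u ⬝ᵥ (P.hess v).mulVec w = P.hessForm v u w := by
  have hform : ∀ k (u : Fin N → ℝ), P.form k u = ∑ i, u i * P.form k (Pi.single i 1) := by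
    intro k u
    have := (P.form k).toLinearMap.pi_apply_eq_sum_univ u
    rw [ContinuousLinearMap.coe_coe] at this
    rw [this]
    refine Finset.sum_congr rfl fun i _ => ?_
    rw [smul_eq_mul]
    congr 2
    ext j
    simp [Pi.single_apply, eq_comm]
  have hterm : ∀ k, P.term k 2 (P.form k v) * (P.form k u * P.form k w)
      = ∑ i, ∑ j, u i * (P.term k 2 (P.form k v)
        * (P.form k (Pi.single i 1) * P.form k (Pi.single j 1)) * w j) := fun k => by
    rw [hform k u, hform k w, Finset.sum_mul_sum, Finset.mul_sum]
    refine Finset.sum_congr rfl fun i _ => ?_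
    rw [Finset.mul_sum]
    exact Finset.sum_congr rfl fun j _ => by ring
  simp only [dotProduct, Matrix.mulVec, hessForm, hess, Matrix.of_apply,
    hP.separable.iteratedFDeriv_two (hP.hatQ_eq ▸ hv), hterm]
  rw [Finset.sum_comm]
  refine Finset.sum_congr rfl fun i _ => ?_
  rw [Finset.sum_comm, Finset.mul_sum]
  refine Finset.sum_congr rfl fun j _ => ?_
  rw [Finset.sum_mul, Finset.mul_sum]

theorem term_mul_nonneg {v : Fin N → ℝ} (hv : v ∈ P.hatQ) (w : Fin N → ℝ) (k) :
    0 ≤ P.term k 2 (P.form k v) * (P.form k w * P.form k w) :=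
  mul_nonneg (hP.term_two_pos (hP.form_mem hv k)).le (mul_self_nonneg _)

theorem hessForm_self_nonneg {v : Fin N → ℝ} (hv : v ∈ P.hatQ) (w : Fin N → ℝ) :
    0 ≤ P.hessForm v w w :=
  Finset.sum_nonneg fun k _ => hP.term_mul_nonneg hv w k

theorem term_le_hessForm {v : Fin N → ℝ} (hv : v ∈ P.hatQ) (w : Fin N → ℝ) (k) :
    P.term k 2 (P.form k v) * (P.form k w * P.form k w) ≤ P.hessForm v w w :=
  Finset.single_le_sum (f := fun k => P.term k 2 (P.form k v) * (P.form k w * P.form k w))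
    (fun k _ => hP.term_mul_nonneg hv w k) (Finset.mem_univ k)

theorem posDef_hess {v : Fin N → ℝ} (hv : v ∈ P.hatQ) : (P.hess v).PosDef := by
  refine Matrix.PosDef.of_dotProduct_mulVec_pos ?_ fun w hw => ?_
  · ext i j
    simp only [Matrix.conjTranspose_apply, star_trivial, hess, Matrix.of_apply,
      hP.separable.iteratedFDeriv_two (hP.hatQ_eq ▸ hv)]
    exact Finset.sum_congr rfl fun k _ => by ring
  · rw [star_trivial, hP.dotProduct_hess hv]
    obtain ⟨j, hj⟩ := Function.ne_iff.1 hw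
    refine lt_of_lt_of_le ?_ (hP.term_le_hessForm hv w (Sum.inr j))
    exact mul_pos (hP.term_two_pos (hP.form_mem hv _)) (mul_self_pos.2 hj)

theorem isUnit_det_hess {v : Fin N → ℝ} (hv : v ∈ P.hatQ) : IsUnit (P.hess v).det :=
  (Matrix.isUnit_iff_isUnit_det _).1 (hP.posDef_hess hv).isUnit

theorem hess_mulVec_eq_iff {v : Fin N → ℝ} (hv : v ∈ P.hatQ) (w : Fin N → ℝ) :
    (P.hess v).mulVec w = -P.grad v ↔ w = P.newtonDir v := by
  have hu := hP.isUnit_det_hess hv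
  constructor
  · intro h
    rw [newtonDir, ← Matrix.mulVec_neg, ← h, Matrix.mulVec_mulVec, Matrix.nonsing_inv_mul _ hu,
      Matrix.one_mulVec]
  · rintro rfl
    rw [newtonDir, Matrix.mulVec_neg, Matrix.mulVec_mulVec, Matrix.mul_nonsing_inv _ hu,
      Matrix.one_mulVec]

theorem fderiv_eq_neg_hessForm {v : Fin N → ℝ} (hv : v ∈ P.hatQ) (u : Fin N → ℝ) :
    fderiv ℝ P.F v u = -P.hessForm v (P.newtonDir v) u := by
  rw [P.hessForm_comm, ← hP.dotProduct_hess hv, (hP.hess_mulVec_eq_iff hv _).2 rfl,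
    dotProduct_neg, neg_neg, dotProduct_comm, P.dotProduct_grad]

/-- Tested against the unit vectors, the linear system is `F'' w = -F'` divided by `h`;
invertibility of the Hessian gives existence and uniqueness together. -/
theorem isNewtonDirection_iff {v : Fin N → ℝ} (hv : v ∈ P.hatQ) (δ : Fin (N + 2) → ℝ) :
    P.IsNewtonDirection (P.grid + extZero v) δ ↔ δ = extZero (P.newtonDir v) := by
  have key : ∀ w : Fin N → ℝ, P.IsNewtonDirection (P.grid + extZero v) (extZero w)
      ↔ w = P.newtonDir v := fun w => by
    rw [← hP.hess_mulVec_eq_iff hv, funext_iff]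
    simp only [IsNewtonDirection, extZero_zero, extZero_last, true_and]
    refine forall_congr' fun j => ?_
    have hg : P.grad v j = fderiv ℝ P.F v (Pi.single j 1) := rfl
    have hH : (P.hess v).mulVec w j = iteratedFDeriv ℝ 2 P.F v ![w, Pi.single j 1] := by
      have : (P.hess v).mulVec w j = Pi.single j 1 ⬝ᵥ (P.hess v).mulVec w := by simp
      rw [this, hP.dotProduct_hess hv, P.hessForm_comm,
        hP.separable.iteratedFDeriv_two (hP.hatQ_eq ▸ hv)]
      rfl
    rw [Pi.neg_apply, hg, hH, hP.fderiv_eq hv, hP.iteratedFDeriv_two_eq hv]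
    simp only [Pi.single_apply, mul_ite, mul_one, mul_zero, Finset.sum_ite_eq', Finset.mem_univ,
      if_true]
    rw [← mul_neg P.h, mul_right_inj' hP.h_pos.ne']
    constructor <;> intro h <;> linarith
  constructor
  · intro h
    have hδ : δ = extZero fun j => δ (interiorIdx j) :=
      node_ext (by simp [h.1]) (by simp [h.2.1]) (by simp)
    rw [hδ] at h ⊢
    rw [(key _).1 h]
  · rintro rfl
    exact (key _).2 rfl

theorem newtonDecrement_sq {a : ℝ} (ha : 0 < a) {v : Fin N → ℝ} (hv : v ∈ P.hatQ) :
    a * P.newtonDecrement a v ^ 2 = P.hessForm v (P.newtonDir v) (P.newtonDir v) := by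
  have h1 : P.grad v ⬝ᵥ (P.hess v)⁻¹.mulVec (P.grad v)
      = P.hessForm v (P.newtonDir v) (P.newtonDir v) := by
    have := hP.fderiv_eq_neg_hessForm hv (P.newtonDir v)
    rw [← P.dotProduct_grad] at this
    rw [← neg_eq_iff_eq_neg.2 this, newtonDir, dotProduct_neg, neg_neg]
  have h2 := hP.hessForm_self_nonneg hv (P.newtonDir v)
  rw [newtonDecrement, h1, Real.sq_sqrt (by positivity)]
  field_simp

variable {a : ℝ} (ha : 0 < a) (hle : 16 * a ≤ P.h * P.τ ^ 2) {v : Fin N → ℝ} (hv : v ∈ P.hatQ)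
include ha hle hv

/-- The Newton direction changes the cell lengths by a relative amount controlled by the Newton
decrement. -/
theorem abs_slope_newtonDir_le (i : Fin (N + 1)) :
    |P.slope i (P.newtonDir v)| ≤ (1 + P.slope i v) * (P.newtonDecrement a v / 4) := by
  have hs := hP.mem_hatQ.1 hv i
  have hy : 0 < 1 + P.slope i v := by linarith
  have hl := P.newtonDecrement_nonneg a v
  refine abs_le_of_sq_le_sq ?_ (by positivity)
  -- A single cell term is at most the whole quadratic form, which equals `aλ²` at the Newton
  -- direction; the barrier bounds that term below by `hτ² d²/(1+s)²`.
  have h1 := hP.term_le_hessForm hv (P.newtonDir v) (Sum.inl i)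
  rw [← hP.newtonDecrement_sq ha hv] at h1
  have h2 : P.h * P.τ ^ 2 * ((1 + P.slope i v) ^ 2)⁻¹ ≤ P.term (Sum.inl i) 2 (P.slope i v) :=
    le_cellFun_two hP.h_pos (hP.fMid_pos i) (hP.Dh_pos hP.xn_mem i) hP.A₀τ_nonneg hs
  set d := P.slope i (P.newtonDir v)
  set lam := P.newtonDecrement a v
  have h3 : P.h * P.τ ^ 2 * ((1 + P.slope i v) ^ 2)⁻¹ * (d * d) ≤ a * lam ^ 2 :=
    (mul_le_mul_of_nonneg_right h2 (mul_self_nonneg d)).trans h1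
  have hc : 0 < P.h * P.τ ^ 2 := mul_pos hP.h_pos (pow_pos hP.τ_pos 2)
  have h4 : P.h * P.τ ^ 2 * (d ^ 2 / (1 + P.slope i v) ^ 2) ≤ P.h * P.τ ^ 2 * (lam / 4) ^ 2 := by
    calc _ = P.h * P.τ ^ 2 * ((1 + P.slope i v) ^ 2)⁻¹ * (d * d) := by ring
      _ ≤ a * lam ^ 2 := h3
      _ ≤ P.h * P.τ ^ 2 / 16 * lam ^ 2 := by gcongr; linarith
      _ = _ := by ring
  have h5 := le_of_mul_le_mul_left h4 hc
  rw [div_le_iff₀ (by positivity)] at h5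
  rw [mul_pow]
  linarith

theorem one_add_slope_step {t : ℝ} (ht : 0 ≤ t) (htl : t * P.newtonDecrement a v ≤ 1)
    (i : Fin (N + 1)) :
    (1 - 1 / 4) * (1 + P.slope i v) ≤ 1 + P.slope i (v + t • P.newtonDir v) := by
  have hs := hP.mem_hatQ.1 hv i
  have h1 := hP.abs_slope_newtonDir_le ha hle hv i
  have h2 : -|P.slope i (P.newtonDir v)| ≤ P.slope i (P.newtonDir v) := neg_abs_le _
  rw [map_add, map_smul, smul_eq_mul]
  have h3 : t * -((1 + P.slope i v) * (P.newtonDecrement a v / 4))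
      ≤ t * P.slope i (P.newtonDir v) :=
    mul_le_mul_of_nonneg_left (by linarith) ht
  nlinarith

theorem step_mem {t : ℝ} (ht : 0 ≤ t) (htl : t * P.newtonDecrement a v ≤ 1) :
    v + t • P.newtonDir v ∈ P.hatQ := by
  refine hP.mem_hatQ.2 fun i => ?_
  have := hP.one_add_slope_step ha hle hv ht htl i
  have := hP.mem_hatQ.1 hv i
  linarith

/-- Along the Newton direction the second derivative of `F` stays comparable. -/
theorem hessForm_step_le {t : ℝ} (ht : 0 ≤ t) (htl : t * P.newtonDecrement a v ≤ 1)
    (w : Fin N → ℝ) :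
    P.hessForm (v + t • P.newtonDir v) w w ≤ 16 / 9 * P.hessForm v w w := by
  rw [hessForm, hessForm, Finset.mul_sum]
  refine Finset.sum_le_sum fun k _ => ?_
  rw [← mul_assoc (16 / 9 : ℝ)]
  refine mul_le_mul_of_nonneg_right ?_ (mul_self_nonneg (P.form k w))
  -- Cells keep three quarters of their length, whence `(3/4)⁻² = 16/9`; node terms have constant
  -- second derivative.
  rcases k with i | j
  · have := cellFun_two_le_of_le hP.h_pos (hP.fMid_pos i) (hP.Dh_pos hP.xn_mem i) hP.A₀τ_nonneg
      (hP.mem_hatQ.1 hv i) (pow_pos hP.τ_pos 2) (by norm_num) (by norm_num)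
      (hP.one_add_slope_step ha hle hv ht htl i)
    refine this.trans (le_of_eq ?_)
    rw [div_eq_inv_mul]
    norm_num
    rfl
  · have : 0 < P.h * P.coeff j / P.τ := hP.weight_pos j
    show P.h * P.coeff j / P.τ ≤ 16 / 9 * (P.h * P.coeff j / P.τ)
    linarith

/-- With `A = aλ²`, the initial slope along the Newton direction is `-A` and the second derivative
is at most `16A/9`, so the change is at most `-At + 8At²/9`, hence at most `-At/9` for `t ≤ 1`. -/
theorem descent {t : ℝ} (ht : 0 ≤ t) (ht1 : t ≤ 1) (htl : t * P.newtonDecrement a v ≤ 1) :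
    P.F (v + t • P.newtonDir v) ≤ P.F v - a * P.newtonDecrement a v ^ 2 * t / 9 := by
  set d := P.newtonDir v with hd
  have hl := P.newtonDecrement_nonneg a v
  have hmem : ∀ s ∈ Icc (0 : ℝ) t, s * P.newtonDecrement a v ≤ 1 := fun s hs =>
    (mul_le_mul_of_nonneg_right hs.2 hl).trans htl
  have hline : ∀ s : ℝ, HasDerivAt (fun s : ℝ => v + s • d) d s := fun s => by
    simpa using ((hasDerivAt_id s).smul_const d).const_add v
  have hQ : ∀ s ∈ Icc (0 : ℝ) t, v + s • d ∈ Separable.domain P.form P.termDomain := fun s hs =>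
    hP.hatQ_eq ▸ hP.step_mem ha hle hv hs.1 (hmem s hs)
  have key := le_quadratic_of_deriv_two_le (q := fun s => P.F (v + s • d))
    (q₁ := fun s => ∑ k, P.term k 1 (P.form k (v + s • d)) * P.form k d)
    (q₂ := fun s => P.hessForm (v + s • d) d d) (B := 16 / 9 * (a * P.newtonDecrement a v ^ 2)) ht
    (fun s hs => ?_) (fun s hs => ?_) (fun s hs => ?_)
  · have h0 : ∑ k, P.term k 1 (P.form k (v + (0 : ℝ) • d)) * P.form k d
        = -(a * P.newtonDecrement a v ^ 2) := by
      rw [zero_smul, add_zero, ← hP.separable.fderiv_apply (hP.hatQ_eq ▸ hv),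
        hP.fderiv_eq_neg_hessForm hv, hP.newtonDecrement_sq ha hv]
    simp only [h0] at key
    rw [zero_smul, add_zero] at key
    have hA : 0 ≤ a * P.newtonDecrement a v ^ 2 := by positivity
    have hA' : 0 ≤ a * P.newtonDecrement a v ^ 2 * (t * (1 - t)) :=
      mul_nonneg hA (mul_nonneg ht (by linarith))
    nlinarith
  · have := (hP.separable.hasFDerivAt (hQ s hs)).comp_hasDerivAt s (hline s)
    refine this.congr_deriv ?_
    simp
  · have := (hP.separable.hasFDerivAt_sum (hQ s hs) (j := 1) (by norm_num)
      (fun k => P.form k d)).comp_hasDerivAt s (hline s)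
    refine this.congr_deriv ?_
    simp [hessForm, mul_assoc]
  · rw [hP.newtonDecrement_sq ha hv]
    exact hP.hessForm_step_le ha hle hv hs.1 (hmem s hs) d

end Admissible
end StepData

/-! ### Compact sublevel sets, the minimizer and convergence -/

namespace StepData

variable {N : ℕ} (P : StepData N)

/-- The set on which every cell has at least the relative length `ε`. -/
def thickSet (ε : ℝ) : Set (Fin N → ℝ) := {v | ∀ i, ε ≤ 1 + P.slope i v}

/-- The damped Newton iteration in the interior variables. -/
def newtonSeq (a lam' : ℝ) : ℕ → Fin N → ℝ
  | 0 => P.hat P.xn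
  | k + 1 => newtonSeq a lam' k + dampingFactor lam' (P.newtonDecrement a (newtonSeq a lam' k)) •
      P.newtonDir (newtonSeq a lam' k)

theorem continuous_extZero : Continuous (extZero : (Fin N → ℝ) → Fin (N + 2) → ℝ) :=
  (LinearMap.mk ⟨extZero, extZero_add⟩ extZero_smul).continuous_of_finiteDimensional

variable {P} (hP : P.Admissible)
include hP

namespace Admissible

theorem one_add_slope_le {v : Fin N → ℝ} (hv : v ∈ P.hatQ) (i : Fin (N + 1)) :
    1 + P.slope i v ≤ N + 1 := by
  have h1 : ∑ i, (1 + P.slope i v) = N + 1 := by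
    rw [Finset.sum_add_distrib]
    have : ∑ i, P.slope i v = 0 := P.sum_Dh_extZero v
    rw [this]
    simp
  rw [← h1]
  exact Finset.single_le_sum (f := fun i => 1 + P.slope i v)
    (fun i _ => by linarith [hP.mem_hatQ.1 hv i]) (Finset.mem_univ i)

/-- The relative cell lengths are positive and sum to `N + 1`, so none is large and every cell term
is bounded below. An upper bound on `F` then bounds each cell term above, and the barrier keeps its
cell from collapsing. -/
theorem exists_thickSet (c : ℝ) :
    ∃ ε : ℝ, 0 < ε ∧ ∀ v ∈ P.hatQ, P.F v ≤ c → v ∈ P.thickSet ε := by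
  have hh := hP.h_pos
  have hβ : 0 < P.τ ^ 2 := pow_pos hP.τ_pos 2
  have hα := hP.A₀τ_nonneg
  have hN : (0 : ℝ) ≤ N + 1 := by positivity
  set Ci : Fin (N + 1) → ℝ := fun i => P.fMid i * (kernelInt 0 (P.Dh P.xn i) 1 * (N + 1))
    + P.A₀ * P.τ * ((N + 1) * P.Dh P.xn i) + P.τ ^ 2 * ((N + 1) / P.Dh P.xn i) with hCi
  have hCi0 : ∀ i, 0 ≤ Ci i := fun i => by
    have := hP.fMid_pos i
    have := hP.Dh_pos hP.xn_mem i
    have := kernelInt_nonneg 0 this one_pos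
    positivity
  set C := ∑ i, Ci i with hC
  have hcell : ∀ v ∈ P.hatQ, ∀ i, P.h * (-C - P.τ ^ 2 * Real.log (1 + P.slope i v))
      ≤ P.term (Sum.inl i) 0 (P.slope i v) := fun v hv i => by
    have hs := hP.mem_hatQ.1 hv i
    have hf := hP.fMid_pos i
    have hp := hP.Dh_pos hP.xn_mem i
    have hK := kernelInt_nonneg 0 hp one_pos
    have habs : |P.slope i v| ≤ N + 1 :=
      abs_le.2 ⟨by linarith [(N.cast_nonneg : (0 : ℝ) ≤ N)], by linarith [hP.one_add_slope_le hv i]⟩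
    refine le_trans ?_ (le_cellFun_zero hh hf hp hα hs hβ)
    have h1 : P.fMid i * (kernelInt 0 (P.Dh P.xn i) 1 * |P.slope i v|)
        + P.A₀ * P.τ * (|P.slope i v| * P.Dh P.xn i) + P.τ ^ 2 * (|P.slope i v| / P.Dh P.xn i)
        ≤ Ci i := by simp only [hCi]; gcongr
    have h2 : Ci i ≤ C := Finset.single_le_sum (fun i _ => hCi0 i) (Finset.mem_univ i)
    exact mul_le_mul_of_nonneg_left (by linarith) hh.le
  set B := P.h * (C + P.τ ^ 2 * Real.log (N + 1)) with hB
  have hcellB : ∀ v ∈ P.hatQ, ∀ i, 0 ≤ P.term (Sum.inl i) 0 (P.slope i v) + B := fun v hv i => by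
    have h1 := hcell v hv i
    have h2 := Real.log_le_log (by linarith [hP.mem_hatQ.1 hv i]) (hP.one_add_slope_le hv i)
    have h3 : 0 ≤ P.h * (P.τ ^ 2 * (Real.log (N + 1) - Real.log (1 + P.slope i v))) :=
      mul_nonneg hh.le (mul_nonneg hβ.le (by linarith))
    rw [hB]
    linarith
  -- The other `N` cells contribute at least `-NB`, so one cell term is at most `c + NB`; `ε` solves
  -- `h(-C - τ² ln ε) = c + NB`.
  refine ⟨Real.exp (-((c + N * B) / P.h + C) / P.τ ^ 2), Real.exp_pos _, fun v hv hc i => ?_⟩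
  rw [← Real.le_log_iff_exp_le (by linarith [hP.mem_hatQ.1 hv i]), div_le_iff₀ hβ]
  have h1 : ∑ i, P.term (Sum.inl i) 0 (P.slope i v) ≤ P.F v := by
    rw [P.F_eq_sum, Fintype.sum_sum_type]
    refine le_add_of_nonneg_right (Finset.sum_nonneg fun j _ => ?_)
    have := (hP.weight_pos j).le
    exact div_nonneg (mul_nonneg this (sq_nonneg _)) zero_le_two
  have h2 := Finset.single_le_sum (f := fun i => P.term (Sum.inl i) 0 (P.slope i v) + B)
    (fun i _ => hcellB v hv i) (Finset.mem_univ i)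
  rw [Finset.sum_add_distrib] at h2
  simp only [Finset.sum_const, Finset.card_univ, Fintype.card_fin, nsmul_eq_mul] at h2
  push_cast at h2
  have h3 := hcell v hv i
  have h4 : P.h * (-C - P.τ ^ 2 * Real.log (1 + P.slope i v)) ≤ c + N * B := by linarith
  rw [← le_div_iff₀' hh] at h4
  linarith

theorem thickSet_subset {ε : ℝ} (hε : 0 < ε) : P.thickSet ε ⊆ P.hatQ := fun v hv =>
  hP.mem_hatQ.2 fun i => by linarith [hv i]

theorem isCompact_thickSet {ε : ℝ} (hε : 0 < ε) : IsCompact (P.thickSet ε) := by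
  have hclosed : IsClosed (P.thickSet ε) := by
    have : P.thickSet ε = ⋂ i, {v | ε ≤ 1 + P.slope i v} := by ext; simp [thickSet]
    rw [this]
    exact isClosed_iInter fun i => isClosed_le continuous_const
      (continuous_const.add (P.slope i).continuous)
  refine (isCompact_Icc (a := fun j => P.X₀ - P.grid (interiorIdx j))
    (b := fun j => P.X₀ + P.L - P.grid (interiorIdx j))).of_isClosed_subset hclosed ?_
  intro v hv
  have hQ : P.grid + extZero v ∈ P.Q := hP.thickSet_subset hε hv
  have hmono : StrictMono (P.grid + extZero v) := Fin.strictMono_iff_lt_succ.2 hQ.1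
  constructor <;> intro j
  · have := hmono.monotone (Fin.zero_le (interiorIdx j))
    rw [hQ.2.1, Pi.add_apply, extZero_interiorIdx] at this
    show P.X₀ - P.grid (interiorIdx j) ≤ v j
    linarith
  · have := hmono.monotone (Fin.le_last (interiorIdx j))
    rw [hQ.2.2, Pi.add_apply, extZero_interiorIdx] at this
    show v j ≤ P.X₀ + P.L - P.grid (interiorIdx j)
    linarith

theorem continuousOn_F : ContinuousOn P.F P.hatQ :=
  hP.hatQ_eq ▸ hP.separable.contDiffOn.continuousOn

theorem exists_minimizer : ∃ v ∈ P.hatQ, IsMinOn P.F P.hatQ v := by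
  have h0 := P.hat_mem hP.xn_mem
  obtain ⟨ε, hε, hK⟩ := hP.exists_thickSet (P.F (P.hat P.xn))
  obtain ⟨v, hv, hmin⟩ := (hP.isCompact_thickSet hε).exists_isMinOn ⟨_, hK _ h0 le_rfl⟩
    (hP.continuousOn_F.mono (hP.thickSet_subset hε))
  refine ⟨v, hP.thickSet_subset hε hv, fun w hw => ?_⟩
  rcases le_total (P.F w) (P.F (P.hat P.xn)) with h | h
  · exact hmin (hK w hw h)
  · exact (hmin (hK _ h0 le_rfl)).trans h

theorem fderiv_eq_zero_of_isMinOn {v : Fin N → ℝ} (hv : v ∈ P.hatQ) (hmin : IsMinOn P.F P.hatQ v) :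
    fderiv ℝ P.F v = 0 :=
  (hmin.isLocalMin ((hP.hatQ_eq ▸ hP.separable.isOpen_domain : IsOpen P.hatQ).mem_nhds
    hv)).fderiv_eq_zero

theorem isSchemeSolution {v : Fin N → ℝ} (hv : v ∈ P.hatQ) (h : fderiv ℝ P.F v = 0) :
    P.IsSchemeSolution (P.grid + extZero v) := by
  refine ⟨hv, fun j => ?_⟩
  have h1 := hP.fderiv_eq hv (Pi.single j 1)
  rw [h] at h1
  simp only [Pi.single_apply, mul_ite, mul_one, mul_zero, Finset.sum_ite_eq', Finset.mem_univ,
    if_true, _root_.zero_apply] at h1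
  have h2 := (mul_eq_zero.1 h1.symm).resolve_left hP.h_pos.ne'
  linarith

/-- The gradient of `F` is monotone, with a quadratic gain in each coordinate. -/
theorem weight_mul_sq_le {v w : Fin N → ℝ} (hv : v ∈ P.hatQ) (hw : w ∈ P.hatQ) (j : Fin N) :
    P.h * P.coeff j / P.τ * (v j - w j) ^ 2
      ≤ fderiv ℝ P.F v (v - w) - fderiv ℝ P.F w (v - w) := by
  rw [hP.separable.fderiv_apply (hP.hatQ_eq ▸ hv), hP.separable.fderiv_apply (hP.hatQ_eq ▸ hw),
    ← Finset.sum_sub_distrib]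
  have hmono : ∀ k, MonotoneOn (P.term k 1) (P.termDomain k) := fun k => by
    refine monotoneOn_of_hasDerivWithinAt_nonneg (f' := P.term k 2) (hP.separable.convex k)
      (fun t ht => (hP.separable.hasDerivAt k 1 (by norm_num) t ht).continuousAt.continuousWithinAt)
      ?_ ?_ <;> intro t ht <;> replace ht := interior_subset ht
    · exact (hP.separable.hasDerivAt k 1 (by norm_num) t ht).hasDerivWithinAt
    · exact (hP.term_two_pos ht).le
  have hterm : ∀ k, 0 ≤ P.term k 1 (P.form k v) * P.form k (v - w)
      - P.term k 1 (P.form k w) * P.form k (v - w) := fun k => by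
    have h1 := hP.form_mem hv k
    have h2 := hP.form_mem hw k
    rw [← sub_mul, map_sub]
    rcases le_total (P.form k v) (P.form k w) with h | h
    · exact mul_nonneg_of_nonpos_of_nonpos (sub_nonpos.2 (hmono k h1 h2 h)) (sub_nonpos.2 h)
    · exact mul_nonneg (sub_nonneg.2 (hmono k h2 h1 h)) (sub_nonneg.2 h)
  refine le_trans (le_of_eq ?_) (Finset.single_le_sum (fun k _ => hterm k)
    (Finset.mem_univ (Sum.inr j)))
  simp only [term, form, Sum.elim_inr, nodeFun, ContinuousLinearMap.proj_apply, Pi.sub_apply]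
  ring

theorem hessForm_sq_le {v : Fin N → ℝ} (hv : v ∈ P.hatQ) (u w : Fin N → ℝ) :
    P.hessForm v u w ^ 2 ≤ P.hessForm v u u * P.hessForm v w w :=
  Finset.sum_sq_le_sum_mul_sum_of_sq_le_mul _ (fun k _ => hP.term_mul_nonneg hv u k)
    (fun k _ => hP.term_mul_nonneg hv w k) fun k _ => le_of_eq (by ring)

theorem continuousOn_hessForm (w : Fin N → ℝ) :
    ContinuousOn (fun v => P.hessForm v (v - w) (v - w)) P.hatQ := by
  refine continuousOn_finsetSum _ fun k _ => ContinuousOn.mul ?_ (by fun_prop)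
  intro v hv
  have h1 := (hP.separable.hasDerivAt k 2 (by norm_num) _ (hP.form_mem hv k)).continuousAt
  exact (h1.comp (P.form k).continuous.continuousAt).continuousWithinAt

/-- Since `F'(v) = 0`, monotonicity bounds the left side by `F'(x)(x - v)`. This is minus the
Hessian form of the Newton direction and `x - v`, so Cauchy–Schwarz produces the factor `√a λ`. -/
theorem weight_mul_sq_le_newtonDecrement {a C : ℝ} (ha : 0 < a) {x v : Fin N → ℝ}
    (hx : x ∈ P.hatQ) (hv : v ∈ P.hatQ) (hcrit : fderiv ℝ P.F v = 0)
    (hC : P.hessForm x (x - v) (x - v) ≤ C) (j : Fin N) :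
    P.h * P.coeff j / P.τ * (x j - v j) ^ 2 ≤ Real.sqrt (a * C) * P.newtonDecrement a x := by
  have hl := P.newtonDecrement_nonneg a x
  have h2 := hP.weight_mul_sq_le hx hv j
  rw [hcrit, hP.fderiv_eq_neg_hessForm hx, _root_.zero_apply, sub_zero] at h2
  have h3 := hP.hessForm_sq_le hx (P.newtonDir x) (x - v)
  rw [← hP.newtonDecrement_sq ha hx] at h3
  have h5 : P.hessForm x (P.newtonDir x) (x - v) ^ 2 ≤ a * C * P.newtonDecrement a x ^ 2 :=
    calc _ ≤ a * P.newtonDecrement a x ^ 2 * P.hessForm x (x - v) (x - v) := h3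
      _ ≤ a * P.newtonDecrement a x ^ 2 * C := by gcongr
      _ = _ := by ring
  refine h2.trans ((neg_le_abs _).trans ?_)
  rw [← Real.sqrt_sq_eq_abs]
  refine (Real.sqrt_le_sqrt h5).trans (le_of_eq ?_)
  rw [Real.sqrt_mul' _ (sq_nonneg _), Real.sqrt_sq hl]

section iteration

variable {a lam' : ℝ} (ha : 0 < a) (hle : 16 * a ≤ P.h * P.τ ^ 2)
  (h0 : 2 - Real.sqrt 3 ≤ lam') (h1 : lam' < 1)
include ha hle h0 h1

theorem newtonSeq_mem (k : ℕ) : P.newtonSeq a lam' k ∈ P.hatQ := by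
  induction k with
  | zero => exact P.hat_mem hP.xn_mem
  | succ k ih =>
    have hl := P.newtonDecrement_nonneg a (P.newtonSeq a lam' k)
    exact hP.step_mem ha hle ih (dampingFactor_pos h0 h1 hl).le (dampingFactor_mul_le_one h0 h1 hl)

theorem F_newtonSeq_succ_le (k : ℕ) :
    P.F (P.newtonSeq a lam' (k + 1)) ≤ P.F (P.newtonSeq a lam' k)
      - a * (1 - lam') / 27 * (P.newtonDecrement a (P.newtonSeq a lam' k) ^ 2
        / (1 + P.newtonDecrement a (P.newtonSeq a lam' k))) := by
  have hv := hP.newtonSeq_mem ha hle h0 h1 k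
  have hl := P.newtonDecrement_nonneg a (P.newtonSeq a lam' k)
  have hd := hP.descent ha hle hv (dampingFactor_pos h0 h1 hl).le (dampingFactor_le_one h0 h1 hl)
    (dampingFactor_mul_le_one h0 h1 hl)
  rw [newtonSeq]
  refine hd.trans (sub_le_sub_left ?_ _)
  have hω := le_dampingFactor h0 h1 hl
  set lam := P.newtonDecrement a (P.newtonSeq a lam' k)
  calc _ = a * lam ^ 2 * ((1 - lam') / 3 / (1 + lam)) / 9 := by ring
    _ ≤ _ := by gcongr

theorem antitone_F_newtonSeq : Antitone fun k => P.F (P.newtonSeq a lam' k) :=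
  antitone_nat_of_succ_le fun k => by
    have hl := P.newtonDecrement_nonneg a (P.newtonSeq a lam' k)
    refine (hP.F_newtonSeq_succ_le ha hle h0 h1 k).trans (sub_le_self _ ?_)
    have : 0 ≤ 1 - lam' := by linarith
    positivity

theorem tendsto_newtonDecrement :
    Tendsto (fun k => P.newtonDecrement a (P.newtonSeq a lam' k)) atTop (𝓝 0) := by
  obtain ⟨v, -, hmin⟩ := hP.exists_minimizer
  have hbdd : BddBelow (range fun k => P.F (P.newtonSeq a lam' k)) :=
    ⟨P.F v, by rintro _ ⟨k, rfl⟩; exact hmin (hP.newtonSeq_mem ha hle h0 h1 k)⟩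
  have hlim := tendsto_atTop_ciInf (hP.antitone_F_newtonSeq ha hle h0 h1) hbdd
  -- The energies decrease and are bounded below, so their consecutive differences vanish in the
  -- limit; these control `λ²/(1+λ)`.
  have hdiff := hlim.sub (hlim.comp (tendsto_add_atTop_nat 1))
  rw [sub_self] at hdiff
  have hc : 0 < a * (1 - lam') / 27 := div_pos (mul_pos ha (by linarith)) (by norm_num)
  refine tendsto_zero_of_sq_div (fun k => P.newtonDecrement_nonneg a _) ?_
  have hdiff' := hdiff.const_mul (a * (1 - lam') / 27)⁻¹
  rw [mul_zero] at hdiff'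
  refine squeeze_zero (fun k => ?_) (fun k => ?_) hdiff'
  · have hl := P.newtonDecrement_nonneg a (P.newtonSeq a lam' k)
    positivity
  · rw [le_inv_mul_iff₀ hc]
    have := hP.F_newtonSeq_succ_le ha hle h0 h1 k
    simp only [Function.comp_apply]
    linarith

theorem tendsto_newtonSeq {v : Fin N → ℝ} (hv : v ∈ P.hatQ) (hmin : IsMinOn P.F P.hatQ v) :
    Tendsto (P.newtonSeq a lam') atTop (𝓝 v) := by
  obtain ⟨ε, hε, hK⟩ := hP.exists_thickSet (P.F (P.newtonSeq a lam' 0))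
  have hmem := hP.newtonSeq_mem ha hle h0 h1
  have hthick : ∀ k, P.newtonSeq a lam' k ∈ P.thickSet ε := fun k =>
    hK _ (hmem k) (hP.antitone_F_newtonSeq ha hle h0 h1 (Nat.zero_le k))
  -- All iterates lie in one compact sublevel region, where the Hessian form of `x - v` is bounded;
  -- this makes the estimate by the decrement uniform in `k`.
  obtain ⟨C, hC⟩ := (hP.isCompact_thickSet hε).exists_bound_of_continuousOn
    ((hP.continuousOn_hessForm v).mono (hP.thickSet_subset hε))
  have hbound : ∀ k j, P.h * P.coeff j / P.τ * (P.newtonSeq a lam' k j - v j) ^ 2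
      ≤ Real.sqrt (a * C) * P.newtonDecrement a (P.newtonSeq a lam' k) := fun k j =>
    hP.weight_mul_sq_le_newtonDecrement ha (hmem k) hv (hP.fderiv_eq_zero_of_isMinOn hv hmin)
      ((le_abs_self _).trans (hC _ (hthick k))) j
  refine tendsto_pi_nhds.2 fun j => ?_
  have hw := hP.weight_pos j
  have hlim := ((hP.tendsto_newtonDecrement ha hle h0 h1).const_mul
    ((P.h * P.coeff j / P.τ)⁻¹ * Real.sqrt (a * C))).sqrt
  rw [mul_zero, Real.sqrt_zero] at hlim
  rw [tendsto_iff_dist_tendsto_zero]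
  refine squeeze_zero (fun _ => dist_nonneg) (fun k => ?_) hlim
  rw [Real.dist_eq]
  refine Real.le_sqrt_of_sq_le ?_
  rw [sq_abs, mul_assoc, le_inv_mul_iff₀ hw]
  exact hbound k j

theorem isDampedNewton_iff (y : ℕ → Fin (N + 2) → ℝ) :
    P.IsDampedNewton a lam' y ↔ y = fun k => P.grid + extZero (P.newtonSeq a lam' k) := by
  have hmem := hP.newtonSeq_mem ha hle h0 h1
  have hstep : ∀ k, P.grid + extZero (P.newtonSeq a lam' (k + 1))
      = P.grid + extZero (P.newtonSeq a lam' k)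
        + dampingFactor lam' (P.newtonDecrement a (P.newtonSeq a lam' k))
          • extZero (P.newtonDir (P.newtonSeq a lam' k)) := fun k => by
    rw [newtonSeq, extZero_add, extZero_smul, add_assoc]
  constructor
  · rintro ⟨hy0, hy⟩
    funext k
    induction k with
    | zero => rw [hy0, newtonSeq, P.grid_add_extZero_hat hP.xn_mem]
    | succ k ih =>
      obtain ⟨δ, hδ, hyk⟩ := hy k
      rw [ih, hP.isNewtonDirection_iff (hmem k)] at hδ
      rw [hyk, hδ, ih, P.hat_grid_add_extZero, hstep]
  · rintro rfl
    refine ⟨P.grid_add_extZero_hat hP.xn_mem, fun k => ⟨extZero (P.newtonDir _),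
      (hP.isNewtonDirection_iff (hmem k) _).2 rfl, ?_⟩⟩
    rw [P.hat_grid_add_extZero]
    exact hstep k

end iteration

end Admissible

end StepData

end

/-! ### Choice of the constant and conclusion -/

theorem theorem7p1 (X₀ L : ℝ) (hL : 0 < L) (f₀ : ℝ → ℝ)
    (hf₀ : ∃ c : ℝ, 0 < c ∧ ∀ X ∈ Set.Icc X₀ (X₀ + L), c ≤ f₀ X)
    (τ : ℝ) (hτ : 0 < τ) :
    ∃ C₀ : ℝ, 0 < C₀ ∧ ∀ C : ℝ, C₀ ≤ C →
      ∀ (N : ℕ) (m A₀ : ℝ), 1 < m → 0 ≤ A₀ →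
      ∀ xn xnm : Fin (N + 2) → ℝ,
      ∀ P : StepData N, P = ⟨X₀, L, f₀, τ, m, A₀, xn, xnm⟩ →
      xn ∈ P.Q → xnm ∈ P.Q →
      ∀ a : ℝ, a = P.h * P.minf / (2 * C ^ 2) →
        IsSelfConcordantOn P.hatQ P.F a ∧
        (∀ v ∈ P.hatQ, (P.hess v).PosDef) ∧
        ∀ lam' : ℝ, 2 - Real.sqrt 3 ≤ lam' → lam' < 1 →
          ∃ x : ℕ → Fin (N + 2) → ℝ,
            P.IsDampedNewton a lam' x ∧
            (∀ y : ℕ → Fin (N + 2) → ℝ, P.IsDampedNewton a lam' y → y = x) ∧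
            (∀ k : ℕ, x k ∈ P.Q) ∧
            ∃ xs : Fin (N + 2) → ℝ,
              P.IsSchemeSolution xs ∧ IsMinOn P.F P.hatQ (P.hat xs) ∧
              Filter.Tendsto x Filter.atTop (nhds xs) := by
  obtain ⟨c, hc, hcf⟩ := hf₀
  have hfX : 0 < f₀ X₀ := hc.trans_le (hcf X₀ ⟨le_rfl, by linarith⟩)
  -- The requirement `16a ≤ hτ²` reads `8 min f₀ ≤ τ²C²`. The minimum is at most `f₀ X₀`, a bound
  -- free of the mesh, and the summand `1` ensures `C ≤ C²`.
  refine ⟨8 * f₀ X₀ / τ ^ 2 + 1, by positivity, ?_⟩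
  intro C hC N m A₀ hm hA₀ xn xnm P hPeq hxn _ a ha
  have hP : P.Admissible := by
    subst hPeq
    exact ⟨hL, hτ, one_pos.trans hm, hA₀, fun X hX => hc.trans_le (hcf X hX), hxn⟩
  have hτP : P.τ = τ := by rw [hPeq]
  have hfP : P.f₀ P.X₀ = f₀ X₀ := by rw [hPeq]
  have hC1 : 1 ≤ C := le_trans (le_add_of_nonneg_left (by positivity)) hC
  have hh := hP.h_pos
  have hmin := hP.minf_pos
  have ha0 : 0 < a := by rw [ha]; positivity
  have hle : 16 * a ≤ P.h * P.τ ^ 2 := by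
    have h1 : 8 * f₀ X₀ ≤ τ ^ 2 * C ^ 2 := by
      rw [← div_le_iff₀' (by positivity)]
      nlinarith
    have h2 : P.minf ≤ f₀ X₀ := hfP ▸ P.minf_le
    rw [ha, hτP, mul_div_assoc', div_le_iff₀ (by positivity)]
    nlinarith [mul_le_mul_of_nonneg_left (h1.trans' (by linarith : 8 * P.minf ≤ 8 * f₀ X₀)) hh.le]
  refine ⟨hP.isSelfConcordantOn ha0 (by linarith), fun v hv => hP.posDef_hess hv,
    fun lam' h0 h1 => ?_⟩
  obtain ⟨v, hv, hvmin⟩ := hP.exists_minimizer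
  have hiff := hP.isDampedNewton_iff ha0 hle h0 h1
  refine ⟨_, (hiff _).2 rfl, fun y hy => (hiff y).1 hy, hP.newtonSeq_mem ha0 hle h0 h1,
    P.grid + extZero v, hP.isSchemeSolution hv (hP.fderiv_eq_zero_of_isMinOn hv hvmin), ?_, ?_⟩
  · rwa [P.hat_grid_add_extZero]
  · exact ((continuous_const.add StepData.continuous_extZero).tendsto v).comp
      (hP.tendsto_newtonSeq ha0 hle h0 h1 hv hvmin)
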